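/- All graphs are finite and simple. Let $G$ be a graph on $n$ vertices with adjacency matrix $A$, let $e$ be the all-one vector and $J$ the all-one $n\times n$ matrix. Let $W(G)=[e,Ae,\ldots,A^{n-1}e]$ be the walk matrix of $G$, and let $\Delta(G)$ be the discriminant of the characteristic polynomial $\chi(A;x)=\det(xI-A)$. Put $$\theta(G)=\gcd\{2^{-\lfloor n/2\rfloor}\det W(G),\,\Delta(G)\},$$ where both entries are integers. For a prime $p$ let $\Phi_p(G;x)=\gcd\{\chi(A;x),\chi(A+J;x)\}\in\mathbb{F}_p[x]$, the gcd being taken over $\mathbb{F}_p$. The graph $G$ is controllable if $\det W(G)\neq 0$. Two graphs are generalized cospectral if they have the same adjacency spectrum (with multiplicities) and their complements have the same adjacency spectrum; $G$ is determined by its generalized spectrum (DGS) if every graph generalized cospectral with $G$ is isomorphic to $G$. Let $G$ be a controllable graph such that $\theta(G)$ is odd. If for every prime $p$ with $p^2\mid\theta(G)$ the polynomial $\Phi_p(G;x)$ is squarefree over $\mathbb{F}_p$, then $G$ is DGS. -/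

import Mathlib

open Polynomial

namespace GenSpec

/-- The spectrum of a graph: the multiset of eigenvalues (with multiplicity) of its adjacency
matrix, that is, the roots in `ℂ` of its characteristic polynomial. -/
noncomputable def adjSpectrum {V : Type*} [Fintype V] [DecidableEq V]
    (G : SimpleGraph V) [DecidableRel G.Adj] : Multiset ℂ :=
  (G.adjMatrix ℂ).charpoly.roots

/-- Two finite graphs are generalized cospectral if they have the same spectrum and
their complements have the same spectrum. -/
def GeneralizedCospectral {V W : Type*} [Fintype V] [DecidableEq V] [Fintype W] [DecidableEq W]
    (G : SimpleGraph V) [DecidableRel G.Adj] (H : SimpleGraph W) [DecidableRel H.Adj] : Prop :=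
  adjSpectrum G = adjSpectrum H ∧ adjSpectrum Gᶜ = adjSpectrum Hᶜ

/-- `G` is determined by its generalized spectrum: every finite graph that is
generalized cospectral with `G` is isomorphic to `G`. -/
def IsDGS {V : Type*} [Fintype V] [DecidableEq V]
    (G : SimpleGraph V) [DecidableRel G.Adj] : Prop :=
  ∀ (W : Type) [Fintype W] [DecidableEq W] (H : SimpleGraph W) [DecidableRel H.Adj],
    GeneralizedCospectral H G → Nonempty (H ≃g G)

/-- The walk matrix `[e, Ae, …, A^{n-1}e]`, with `e` the all-one vector. -/
def walkMatrix {n : ℕ} (G : SimpleGraph (Fin n)) [DecidableRel G.Adj] :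
    Matrix (Fin n) (Fin n) ℤ :=
  Matrix.of fun i j => Matrix.mulVec (G.adjMatrix ℤ ^ (j : ℕ)) (fun _ => 1) i

/-- A graph is controllable if its walk matrix is nonsingular. -/
def IsControllable {n : ℕ} (G : SimpleGraph (Fin n)) [DecidableRel G.Adj] : Prop :=
  (walkMatrix G).det ≠ 0

/-- The discriminant of a graph: the discriminant of the characteristic polynomial of its
adjacency matrix. -/
noncomputable def discriminant {V : Type*} [Fintype V] [DecidableEq V]
    (G : SimpleGraph V) [DecidableRel G.Adj] : ℤ :=
  (G.adjMatrix ℤ).charpoly.discr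

/-- `xᵀ A x = 0` over `𝔽₂` for a symmetric matrix with zero diagonal. -/
lemma dotProduct_mulVec_self_mod_two {n : ℕ} {A : Matrix (Fin n) (Fin n) (ZMod 2)}
    (hA : A.transpose = A) (hd : ∀ i, A i i = 0) (x : Fin n → ZMod 2) :
    dotProduct x (A.mulVec x) = 0 := by
  have h : dotProduct x (A.mulVec x) =
      ∑ q ∈ (Finset.univ : Finset (Fin n × Fin n)), x q.1 * (A q.1 q.2 * x q.2) := by
    simp only [dotProduct, Matrix.mulVec, Finset.mul_sum]
    rw [← Finset.univ_product_univ, Finset.sum_product]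
  rw [h]
  refine Finset.sum_involution (fun q _ => (q.2, q.1)) ?_ ?_ ?_ ?_
  · rintro ⟨i, j⟩ -
    have : A j i = A i j := congrFun (congrFun hA i) j
    simp only [this]
    have e : x j * (A i j * x i) = x i * (A i j * x j) := by ring
    rw [e]
    exact CharTwo.add_self_eq_zero _
  · rintro ⟨i, j⟩ - hne heq
    simp only [Prod.mk.injEq] at heq
    obtain ⟨h1, -⟩ := heq
    subst h1
    simp [hd] at hne
  · simp
  · simp

/-- The number of walks of any positive length is even. -/
lemma walk_sum_mod_two {n : ℕ} {A : Matrix (Fin n) (Fin n) (ZMod 2)}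
    (hA : A.transpose = A) (hd : ∀ i, A i i = 0) (m : ℕ) (hm : 1 ≤ m) :
    dotProduct (fun _ => 1) ((A ^ m).mulVec (fun _ => 1)) = 0 := by
  have key : ∀ s t : ℕ, dotProduct (fun _ => 1) ((A ^ (s + t)).mulVec (fun _ => 1)) =
      dotProduct ((A ^ s).mulVec (fun _ => 1)) ((A ^ t).mulVec (fun _ => 1)) := by
    intro s t
    rw [pow_add, ← Matrix.mulVec_mulVec, Matrix.dotProduct_mulVec, ← Matrix.mulVec_transpose,
      Matrix.transpose_pow, hA]
  induction m using Nat.strong_induction_on with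
  | _ m ih =>
    obtain ⟨s, rfl | rfl⟩ := Nat.even_or_odd' m
    · have h2 : 2 * s = s + s := by ring
      rw [h2, key, ← ih s (by omega) (by omega)]
      have hsq : ∀ a : ZMod 2, a * a = a := by decide
      simp [dotProduct, hsq]
    · have h2 : 2 * s + 1 = s + (1 + s) := by ring
      rw [h2, key, pow_add, pow_one, ← Matrix.mulVec_mulVec]
      exact dotProduct_mulVec_self_mod_two hA hd _

/-- An integral matrix whose reduction modulo `2` has rank at most `n - k` has determinant
divisible by `2 ^ k`. -/
lemma two_pow_dvd_det {n k : ℕ} (M : Matrix (Fin n) (Fin n) ℤ)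
    (hk : (M.map (Int.castRingHom (ZMod 2))).rank + k ≤ n) : (2 : ℤ) ^ k ∣ M.det := by
  classical
  set B := M.map (Int.castRingHom (ZMod 2)) with hB
  set K := LinearMap.ker B.mulVecLin with hK
  have hdim : k ≤ Module.finrank (ZMod 2) K := by
    have := LinearMap.finrank_range_add_finrank_ker B.mulVecLin
    simp only [Module.finrank_fin_fun] at this
    change _ + Module.finrank (ZMod 2) K = n at this
    have h2 : B.rank = Module.finrank (ZMod 2) (LinearMap.range B.mulVecLin) := rfl
    omega
  obtain ⟨L, hL⟩ := Submodule.exists_isCompl K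
  let b₀ := ((Module.finBasis (ZMod 2) K).prod (Module.finBasis (ZMod 2) L)).map
    (Submodule.prodEquivOfIsCompl K L hL)
  have hcard : Fintype.card (Fin (Module.finrank (ZMod 2) K) ⊕ Fin (Module.finrank (ZMod 2) L))
      = Fintype.card (Fin n) := by
    rw [← Module.finrank_eq_card_basis b₀]; simp
  let e := Fintype.equivOfCardEq hcard
  let b := b₀.reindex e
  have hb : ∀ i, B.mulVec (b (e (Sum.inl i))) = 0 := by
    intro i
    have : b (e (Sum.inl i)) ∈ K := by simp [b, b₀]
    simpa [hK] using this
  let P : Matrix (Fin n) (Fin n) ℤ := Matrix.of fun i j => ((b j i).val : ℤ)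
  have hP : P.map (Int.castRingHom (ZMod 2)) = (Pi.basisFun (ZMod 2) (Fin n)).toMatrix b := by
    ext i j
    simp [P, Module.Basis.toMatrix_apply]
  have hPdet : ¬ (2 : ℤ) ∣ P.det := by
    intro h
    have h0 : ((P.det : ℤ) : ZMod 2) = 0 := (ZMod.intCast_zmod_eq_zero_iff_dvd _ 2).2 h
    have h1 : ((P.det : ℤ) : ZMod 2) = (P.map (Int.castRingHom (ZMod 2))).det :=
      RingHom.map_det (Int.castRingHom (ZMod 2)) P
    rw [h0, hP] at h1
    have h2 : IsUnit ((Pi.basisFun (ZMod 2) (Fin n)).toMatrix b).det :=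
      Matrix.isUnit_det_of_right_inverse
        (Module.Basis.toMatrix_mul_toMatrix_flip (Pi.basisFun (ZMod 2) (Fin n)) b)
    rw [← h1] at h2
    exact not_isUnit_zero h2
  let S : Finset (Fin n) := Finset.univ.filter fun j => B.mulVec (b j) = 0
  have hS : k ≤ S.card := by
    refine hdim.trans ?_
    rw [← Fintype.card_fin (Module.finrank (ZMod 2) K), ← Finset.card_univ]
    refine Finset.card_le_card_of_injOn (fun i => e (Sum.inl i)) ?_ ?_
    · intro i _
      simp [S, hb]
    · intro i _ j _ hij
      exact Sum.inl_injective (e.injective hij)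
  have hcol : ∀ i j, (if j ∈ S then (2 : ℤ) else 1) ∣ (M * P) i j := by
    intro i j
    split_ifs with hj
    · refine (ZMod.intCast_zmod_eq_zero_iff_dvd _ 2).1 ?_
      have hj' : B.mulVec (b j) = 0 := by simpa [S] using hj
      have := congrFun hj' i
      simpa [Matrix.mul_apply, Matrix.mulVec, dotProduct, hB, P] using this
    · exact one_dvd _
  choose N hN using hcol
  have hMP : M * P = Matrix.of N * Matrix.diagonal fun j => if j ∈ S then (2 : ℤ) else 1 := by
    ext i j
    rw [Matrix.mul_diagonal, hN, mul_comm]; rfl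
  have hdet : M.det * P.det = (Matrix.of N).det * 2 ^ S.card := by
    rw [← Matrix.det_mul, hMP, Matrix.det_mul, Matrix.det_diagonal]
    simp
  have hcop : IsCoprime ((2 : ℤ) ^ k) P.det :=
    ((Int.prime_two.coprime_iff_not_dvd).2 hPdet).pow_left
  refine hcop.dvd_of_dvd_mul_right ?_
  rw [hdet]
  exact (pow_dvd_pow 2 hS).mul_left _

/-- `2 ^ ⌊n/2⌋` divides the determinant of the walk matrix. -/
theorem two_pow_dvd_det_walkMatrix {n : ℕ} (G : SimpleGraph (Fin n)) [DecidableRel G.Adj] :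
    (2 : ℤ) ^ (n / 2) ∣ (walkMatrix G).det := by
  apply two_pow_dvd_det
  set A := G.adjMatrix (ZMod 2) with hAdef
  have hA : A.transpose = A := SimpleGraph.transpose_adjMatrix G
  have hd : ∀ i, A i i = 0 := by intro i; simp [A]
  have hAmap : (G.adjMatrix ℤ).map (Int.castRingHom (ZMod 2)) = A := by
    ext i j
    simp only [Matrix.map_apply, SimpleGraph.adjMatrix_apply, A]
    split_ifs <;> simp
  set B := (walkMatrix G).map (Int.castRingHom (ZMod 2)) with hB
  have hBe : ∀ i j, B i j = (A ^ (j : ℕ)).mulVec (fun _ => 1) i := by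
    intro i j
    rw [← hAmap, ← Matrix.map_pow]
    simp [hB, walkMatrix, Matrix.mulVec, dotProduct]
  have hBB : ∀ i j : Fin n, 1 ≤ (i : ℕ) + j → (B.transpose * B) i j = 0 := by
    intro i j hij
    rw [← walk_sum_mod_two hA hd _ hij, pow_add, ← Matrix.mulVec_mulVec, Matrix.dotProduct_mulVec,
      ← Matrix.mulVec_transpose, Matrix.transpose_pow, hA]
    simp [Matrix.mul_apply, dotProduct, hBe]
  rcases Nat.eq_zero_or_pos n with h0 | hn
  · have := B.rank_le_card_width
    simp only [Fintype.card_fin] at this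
    omega
  let z : Fin n := ⟨0, hn⟩
  rcases Nat.even_or_odd' n with ⟨s, hs | hs⟩
  · have hz : B.transpose * B = 0 := by
      ext i j
      by_cases hij : 1 ≤ (i : ℕ) + j
      · exact hBB i j hij
      · have hi : (i : ℕ) = 0 := by omega
        have hj : (j : ℕ) = 0 := by omega
        have hn2 : ((n : ℕ) : ZMod 2) = 0 := by
          rw [ZMod.natCast_eq_zero_iff]; exact ⟨s, hs⟩
        simp [Matrix.mul_apply, hBe, hi, hj, hn2]
    have := Matrix.rank_add_rank_le_card_of_mul_eq_zero hz
    rw [Matrix.rank_transpose, Fintype.card_fin] at this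
    omega
  · let C : Matrix (Fin n) (Fin n) (ZMod 2) := B.updateCol z 0
    have hz : C.transpose * B = 0 := by
      ext i j
      by_cases hi : i = z
      · simp [C, Matrix.mul_apply, hi]
      · have h1 : 1 ≤ (i : ℕ) + j := by
          have : (i : ℕ) ≠ 0 := fun h => hi (Fin.ext h)
          omega
        rw [Matrix.zero_apply, ← hBB i j h1]
        simp [C, Matrix.mul_apply, hi]
    have h1 := Matrix.rank_add_rank_le_card_of_mul_eq_zero hz
    rw [Matrix.rank_transpose, Fintype.card_fin] at h1
    have hBC : B = C + Matrix.vecMulVec (fun i => B i z) (Pi.single z 1) := by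
      ext i j
      by_cases hj : j = z
      · subst hj; simp [C, Matrix.vecMulVec_apply]
      · simp [C, Matrix.vecMulVec_apply, hj]
    have h2 : B.rank ≤ C.rank + 1 := by
      have h3 : B.rank ≤ C.rank + (Matrix.vecMulVec (fun i => B i z) (Pi.single z 1)).rank := by
        rw [Matrix.rank, congrArg Matrix.mulVecLin hBC, Matrix.mulVecLin_add]
        refine (Submodule.finrank_mono (LinearMap.range_add_le _ _)).trans ?_
        exact Submodule.finrank_add_le_finrank_add_finrank _ _
      have h4 := Matrix.rank_vecMulVec_le (fun i => B i z) (Pi.single z (1 : ZMod 2))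
      omega
    omega

/-- `gcd (2^{-⌊n/2⌋} det W, Δ)`. The integer division is exact by
`two_pow_dvd_det_walkMatrix`. -/
noncomputable def theta {n : ℕ} (G : SimpleGraph (Fin n)) [DecidableRel G.Adj] : ℕ :=
  Int.gcd ((walkMatrix G).det / 2 ^ (n / 2)) (discriminant G)

open Classical in
/-- The monic greatest common divisor over `𝔽_p` of the characteristic polynomials of `A` and
`A + J`, with `J` the all-one matrix. -/
noncomputable def Phi (p : ℕ) [Fact p.Prime] {V : Type*} [Fintype V] [DecidableEq V]
    (G : SimpleGraph V) [DecidableRel G.Adj] : (ZMod p)[X] :=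
  normalize (EuclideanDomain.gcd (G.adjMatrix (ZMod p)).charpoly
    (G.adjMatrix (ZMod p) + Matrix.of fun _ _ => 1).charpoly)

end GenSpec

/-!
Let `H` be generalized cospectral with `G`, let `A` and `B` be the adjacency matrices and `e` the
all-one vector. The coefficients of `χ(A + tJ) = χ(A) - t eᵀ adj(x - A) e` show that the two spectra
determine all walk counts `eᵀ Aᵏ e`, so `W(G)` and `W(H)` have the same Gram matrix and
`Q = W(G) W(H)⁻¹` is a rational orthogonal matrix with `Q e = e` and `A Q = Q B`. If `Q` is integral
then it is a permutation matrix and `G ≅ H`. Otherwise some prime `p` divides the least common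
denominator `ℓ` of `Q`, and a column `v` of `ℓ Q` that is nonzero modulo `p` is *walk-isotropic*:
`vᵀ Aᵏ v ≡ 0` modulo `p ^ 2` and `eᵀ Aᵏ v ≡ 0` modulo `p` for all `k`. Such a vector is excluded for
every prime, as follows.

Over `𝔽_p` the vectors `Aᵏ v` span a totally isotropic `A`-invariant subspace `U` orthogonal to `e`.
If `f` is the characteristic polynomial of `A` on `U`, then `f ^ 2` divides that of `A`
(`charpoly_restrict_sq_dvd`) and that of `A + J`, which acts on `U` as `A` does; so `Φ_p` is not
squarefree. By hypothesis it remains, for odd `p`, to see that `p ^ 2 ∣ θ`.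

* `p ^ 2 ∣ Δ`: up to sign `Δ = det χ'(A)`, and `f ∣ χ'` gives `χ'(A) v ≡ 0` modulo `p`. A symmetric
  integral matrix `M` with `M v ≡ 0` modulo `p` and `vᵀ M v ≡ 0` modulo `p ^ 2` has determinant
  divisible by `p ^ 2` (`sq_dvd_det_of_isSymm`).
* `p ^ 2 ∣ det W`: this is clear if `v` and `A v`, both in the kernel of `Wᵀ` modulo `p`, are
  independent modulo `p`. Otherwise `v` is an eigenvector modulo `p`, with eigenvalue `0` after a
  shift of `A`, which does not change `det W`. Then the characteristic polynomials of `A` and of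
  `A + J` both have constant coefficient divisible by `p ^ 2` and linear coefficient divisible by
  `p`; by Cayley–Hamilton this yields two independent vectors that `Wᵀ W` sends to multiples of
  `p ^ 2` and `p`, whence `p ^ 3 ∣ det W ^ 2` (`sq_dvd_det_walkMat_of_coeff`).

For `p = 2`, oddness of `θ` forces `2^{-⌊n/2⌋} det W` to be odd, because `Δ` is even as soon as
`det W` is (`two_dvd_discr`). Then the kernel of `Wᵀ` modulo two has dimension `⌊n/2⌋`, so
`v ≡ ∑ xᵢ Aⁱ e` with `⌊n/2⌋` consecutive exponents. The walk counts that occur are even, hence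
`vᵀ Aᵏ v ≡ ∑ xᵢ eᵀ A^{2i+k} e` modulo four, and this vanishes for all `k` only if `x ≡ 0`, because
the Gram matrix `Wᵀ W`, once its even columns are halved, has odd determinant
(`eq_zero_of_four_dvd`).
-/

open Matrix Polynomial

/-! ### Divisibility of determinants -/

/-- A linearly independent family of coordinate vectors is part of a basis. -/
lemma exists_basis_sum_extending {F ι κ : Type*} [Field F] [Fintype ι] [Fintype κ]
    (v : κ → ι → F) (hv : LinearIndependent F v) :
    ∃ (r : ℕ) (b : Module.Basis (κ ⊕ Fin r) F (ι → F)), ∀ k, b (Sum.inl k) = v k := by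
  obtain ⟨L, hL⟩ := Submodule.exists_isCompl (Submodule.span F (Set.range v))
  refine ⟨_, ((Module.Basis.span hv).prod (Module.finBasis F L)).map
    (Submodule.prodEquivOfIsCompl _ L hL), fun k => ?_⟩
  simp [Module.Basis.span_apply]

/-- Integral vectors that are linearly independent modulo `p` and that `M` sends into
`p ^ d k` times the integral lattice force `p ^ ∑ d k` to divide `det M`. -/
lemma pow_sum_dvd_det {ι κ : Type*} [Fintype ι] [DecidableEq ι] [Fintype κ]
    {p : ℕ} [hp : Fact p.Prime] (M : Matrix ι ι ℤ) (v : κ → ι → ℤ)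
    (hv : LinearIndependent (ZMod p) fun k i => (v k i : ZMod p)) (d : κ → ℕ)
    (hd : ∀ k i, (p : ℤ) ^ d k ∣ (M *ᵥ v k) i) : (p : ℤ) ^ ∑ k, d k ∣ M.det := by
  classical
  obtain ⟨r, b, hb⟩ := exists_basis_sum_extending _ hv
  let e : κ ⊕ Fin r ≃ ι := b.indexEquiv (Pi.basisFun (ZMod p) ι)
  let w : κ ⊕ Fin r → ι → ℤ := Sum.elim v fun k i => ((b (Sum.inr k) i).val : ℤ)
  have hw : ∀ k i, ((w k i : ℤ) : ZMod p) = b k i := by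
    rintro (k | k) i
    · simp [w, hb]
    · simp [w]
  let P : Matrix ι ι ℤ := Matrix.of fun i j => w (e.symm j) i
  let D : ι → ℕ := fun j => Sum.elim d (fun _ => 0) (e.symm j)
  have hP : P.map (Int.castRingHom (ZMod p)) =
      (Pi.basisFun (ZMod p) ι).toMatrix (b.reindex e) := by
    ext i j
    simp [P, Module.Basis.toMatrix_apply, hw]
  have hPdet : ¬ (p : ℤ) ∣ P.det := by
    intro h
    have h0 : ((P.det : ℤ) : ZMod p) = 0 := (ZMod.intCast_zmod_eq_zero_iff_dvd _ p).2 h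
    have h1 : ((P.det : ℤ) : ZMod p) = (P.map (Int.castRingHom (ZMod p))).det :=
      RingHom.map_det (Int.castRingHom (ZMod p)) P
    rw [h0, hP] at h1
    have h2 : IsUnit ((Pi.basisFun (ZMod p) ι).toMatrix (b.reindex e)).det :=
      Matrix.isUnit_det_of_right_inverse
        (Module.Basis.toMatrix_mul_toMatrix_flip (Pi.basisFun (ZMod p) ι) (b.reindex e))
    rw [← h1] at h2
    exact not_isUnit_zero h2
  have hcol : ∀ i j, (p : ℤ) ^ D j ∣ (M * P) i j := by
    intro i j
    have hMP : (M * P) i j = (M *ᵥ w (e.symm j)) i := by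
      simp [Matrix.mul_apply, Matrix.mulVec, dotProduct, P]
    rw [hMP]
    rcases h : e.symm j with k | k
    · simpa [D, h, w] using hd k i
    · simp [D, h]
  choose N hN using hcol
  have hMP : M * P = Matrix.of N * Matrix.diagonal fun j => (p : ℤ) ^ D j := by
    ext i j
    rw [Matrix.mul_diagonal, hN, mul_comm]; rfl
  have hsum : ∑ j, D j = ∑ k, d k := by
    rw [← e.sum_comp]
    simp [D]
  have hdet : M.det * P.det = (Matrix.of N).det * (p : ℤ) ^ ∑ k, d k := by
    rw [← Matrix.det_mul, hMP, Matrix.det_mul, Matrix.det_diagonal, Finset.prod_pow_eq_pow_sum,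
      hsum]
  have hcop : IsCoprime ((p : ℤ) ^ ∑ k, d k) P.det :=
    (((Nat.prime_iff_prime_int.1 hp.out).coprime_iff_not_dvd).2 hPdet).pow_left
  exact hcop.dvd_of_dvd_mul_right (hdet ▸ Dvd.intro_left _ rfl)

/-- A symmetric integral matrix `M` has determinant divisible by `p ^ 2` as soon as some vector
`v`, nonzero modulo `p`, lies in the kernel of `M` modulo `p` and satisfies
`v ⬝ M v ≡ 0 [ZMOD p ^ 2]`: after a base change with `v` as a basis vector, one row and one column
are divisible by `p` and the entry at their crossing by `p ^ 2`. -/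
lemma sq_dvd_det_of_isSymm {ι : Type*} [Fintype ι] [DecidableEq ι] {p : ℤ} (hp : Prime p)
    (M : Matrix ι ι ℤ) (hM : M.IsSymm) (v : ι → ℤ) (i : ι) (hvi : ¬ p ∣ v i)
    (hMv : ∀ j, p ∣ (M *ᵥ v) j) (hvMv : p ^ 2 ∣ v ⬝ᵥ M *ᵥ v) : p ^ 2 ∣ M.det := by
  choose u hu using hMv
  have hu' : M *ᵥ v = p • u := by ext j; simp [hu]
  have hvu : p ∣ v ⬝ᵥ u := by
    rw [hu', dotProduct_smul, smul_eq_mul, sq] at hvMv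
    exact Int.dvd_of_mul_dvd_mul_left hp.ne_zero hvMv
  have h1 : M.det * v i = p * (M.updateCol i u).det := by
    have hP : ((1 : Matrix ι ι ℤ).updateCol i v).det = v i := by
      rw [← Matrix.cramer_apply, Matrix.cramer_one]; rfl
    rw [← hP, ← Matrix.det_mul, Matrix.mul_updateCol, Matrix.mul_one, hu',
      Matrix.det_updateCol_smul]
  have h2 : p ∣ (M.updateCol i u).det := by
    have hX : v i * (M.updateCol i u).det =
        (((1 : Matrix ι ι ℤ).updateRow i v) * M.updateCol i u).det := by
      have hP : ((1 : Matrix ι ι ℤ).updateRow i v).det = v i := by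
        rw [← Matrix.det_transpose, ← Matrix.updateCol_transpose, Matrix.transpose_one,
          ← Matrix.cramer_apply, Matrix.cramer_one]; rfl
      rw [Matrix.det_mul, hP]
    have hrow : v ᵥ* M.updateCol i u = p • Function.update u i ((v ⬝ᵥ u) / p) := by
      rw [Matrix.vecMul_updateCol, ← Matrix.mulVec_transpose, hM.eq, hu']
      ext j
      rcases eq_or_ne j i with rfl | hj
      · simp [Int.mul_ediv_cancel' hvu]
      · simp [hj]
    refine (hp.dvd_or_dvd (?_ : p ∣ v i * _)).resolve_left hvi
    rw [hX, Matrix.updateRow_mul, hrow, Matrix.det_updateRow_smul]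
    exact dvd_mul_right _ _
  refine (hp.pow_dvd_of_dvd_mul_right 2 hvi) ?_
  rw [h1, sq]
  exact mul_dvd_mul_left p h2

/-! ### Totally isotropic invariant subspaces -/

/-- In a basis whose first block of columns `U` spans a totally isotropic invariant subspace on
which `A` acts through `T`, the symmetric matrix `x - A` has a zero block, and the two blocks next
to it are divisible by `x - T` and its transpose. -/
lemma charpoly_sq_dvd_of_isotropic {R κ s : Type*} [CommRing R] [Fintype κ] [DecidableEq κ]
    [Fintype s] [DecidableEq s] (A : Matrix (κ ⊕ s) (κ ⊕ s) R) (hA : A.IsSymm)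
    (U : Matrix (κ ⊕ s) κ R) (V : Matrix (κ ⊕ s) s R) (T : Matrix κ κ R)
    (hUV : IsUnit (fromCols U V).det) (hT : A * U = U * T) (hU : Uᵀ * U = 0) :
    T.charpoly ^ 2 ∣ A.charpoly := by
  set N := A.charmatrix
  set U' := U.map (C : R → R[X])
  set V' := V.map (C : R → R[X])
  have hN : N * U' = U' * T.charmatrix := by
    have h1 : (A.map C) * U' = U' * T.map C := by
      rw [← Matrix.map_mul, hT, Matrix.map_mul]
    simp only [N, charmatrix, Matrix.sub_mul, Matrix.mul_sub, RingHom.mapMatrix_apply, h1]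
    congr 1
    ext1 i j
    simp [mul_comm]
  have hNt : Nᵀ = N := by
    have : A.map C = (A.map (C : R → R[X]))ᵀ := by rw [← Matrix.transpose_map, hA.eq]
    simp [N, charmatrix, ← this]
  have hN' : U'ᵀ * N = T.charmatrixᵀ * U'ᵀ := by
    rw [← Matrix.transpose_mul, ← hN, Matrix.transpose_mul, hNt]
  have hUU : U'ᵀ * U' = 0 := by
    rw [← Matrix.transpose_map, ← Matrix.map_mul, hU]; simp
  have hdet : A.charpoly * (fromCols U' V').det ^ 2 =
      (T.charmatrixᵀ).det * (fromBlocks 0 (U'ᵀ * V') (V'ᵀ * U') (V'ᵀ * N * V')).det *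
        T.charmatrix.det := by
    have h1 : (fromCols U' V')ᵀ * N * fromCols U' V' =
        fromBlocks T.charmatrixᵀ 0 0 1 *
          fromBlocks 0 (U'ᵀ * V') (V'ᵀ * U') (V'ᵀ * N * V') *
          fromBlocks T.charmatrix 0 0 1 := by
      rw [transpose_fromCols, fromRows_mul, fromRows_mul_fromCols, hN', Matrix.mul_assoc V'ᵀ N U',
        hN, Matrix.mul_assoc _ U'ᵀ U', hUU, fromBlocks_multiply, fromBlocks_multiply]
      simp [Matrix.mul_assoc]
    have h2 := congrArg Matrix.det h1
    simp only [Matrix.det_mul, det_fromBlocks_zero₁₂, Matrix.det_one, mul_one,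
      Matrix.det_transpose (fromCols U' V')] at h2
    rw [Matrix.charpoly, ← h2]; ring
  have hu : IsUnit ((fromCols U' V').det ^ 2) := by
    have : fromCols U' V' = (fromCols U V).map C := by
      ext i (j | j) <;> simp [U', V']
    rw [this]
    have h3 := RingHom.map_det (C : R →+* R[X]) (fromCols U V)
    rw [RingHom.mapMatrix_apply] at h3
    rw [← h3]
    exact (hUV.map C).pow 2
  rw [← hu.dvd_mul_right, hdet, Matrix.det_transpose, sq]
  exact ⟨_, mul_right_comm _ _ _⟩

/-- The characteristic polynomial of a symmetric matrix is divisible by the square of the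
characteristic polynomial of its restriction to a totally isotropic invariant subspace. -/
lemma charpoly_restrict_sq_dvd {F ι : Type*} [Field F] [Fintype ι] [DecidableEq ι]
    (A : Matrix ι ι F) (hA : A.IsSymm) (U : Submodule F (ι → F))
    (hU : ∀ u ∈ U, A.mulVecLin u ∈ U) (hiso : ∀ u ∈ U, ∀ w ∈ U, u ⬝ᵥ w = 0) :
    (A.mulVecLin.restrict hU).charpoly ^ 2 ∣ A.charpoly := by
  classical
  let c := Module.finBasis F U
  obtain ⟨r, b, hb⟩ := exists_basis_sum_extending (fun k => (c k : ι → F))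
    (c.linearIndependent.map' U.subtype U.ker_subtype)
  let e := b.indexEquiv (Pi.basisFun F ι)
  rw [← LinearMap.charpoly_toMatrix _ c, ← Matrix.charpoly_reindex e.symm A]
  refine charpoly_sq_dvd_of_isotropic _ (by simpa using hA.submatrix e)
    (Matrix.of fun i j => (c j : ι → F) (e i)) (Matrix.of fun i j => b (Sum.inr j) (e i)) _ ?_ ?_ ?_
  · have h1 : fromCols (Matrix.of fun i j => (c j : ι → F) (e i))
        (Matrix.of fun i j => b (Sum.inr j) (e i)) =
        ((Pi.basisFun F ι).reindex e.symm).toMatrix b := by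
      ext i (j | j) <;> simp [Module.Basis.toMatrix_apply, hb]
    rw [h1]
    exact Matrix.isUnit_det_of_right_inverse (Module.Basis.toMatrix_mul_toMatrix_flip _ b)
  · ext i j
    have h1 : (A *ᵥ (c j : ι → F)) = ∑ k, (LinearMap.toMatrix c c (A.mulVecLin.restrict hU)) k j •
        (c k : ι → F) := by
      have h2 := congrArg Subtype.val (c.sum_repr (A.mulVecLin.restrict hU (c j)))
      rw [← Submodule.subtype_apply, map_sum] at h2
      simpa [LinearMap.toMatrix_apply] using h2.symm
    have h3 := congrFun h1 (e i)
    simp only [Finset.sum_apply, Pi.smul_apply, smul_eq_mul] at h3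
    have h4 : (A *ᵥ (c j : ι → F)) (e i) = ∑ k, A (e i) (e k) * (c j : ι → F) (e k) := by
      rw [Matrix.mulVec, dotProduct, ← e.sum_comp]
    rw [h4] at h3
    simpa [Matrix.mul_apply, mul_comm] using h3
  · ext i j
    have := hiso _ (c i).2 _ (c j).2
    rw [dotProduct, ← e.sum_comp] at this
    simpa [Matrix.mul_apply] using this

/-- On an invariant subspace, a polynomial in a matrix acts as the same polynomial in the
restriction. -/
lemma aeval_mulVec_eq_aeval_restrict {F ι : Type*} [Field F] [Fintype ι] [DecidableEq ι]
    (A : Matrix ι ι F) (U : Submodule F (ι → F)) (hU : ∀ u ∈ U, A.mulVecLin u ∈ U)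
    (q : F[X]) (u : U) :
    (aeval A q) *ᵥ (u : ι → F) = (aeval (A.mulVecLin.restrict hU) q u : U) := by
  induction q using Polynomial.induction_on generalizing u with
  | C a => simp [Algebra.algebraMap_eq_smul_one, Matrix.smul_mulVec]
  | add p q hp hq => simp [Matrix.add_mulVec, hp, hq]
  | monomial k a ih =>
    have h := ih (A.mulVecLin.restrict hU u)
    have h1 : (C a * X ^ (k + 1) : F[X]) = C a * X ^ k * X := by ring
    rw [h1, map_mul (aeval A) _ X, map_mul (aeval (A.mulVecLin.restrict hU)) _ X, aeval_X, aeval_X,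
      ← Matrix.mulVec_mulVec]
    exact h

/-- If the restriction of the symmetric matrix `A` to a totally isotropic invariant subspace has
characteristic polynomial `f`, then `f ^ 2` divides that of `A`, so `f` divides its derivative,
which therefore annihilates the subspace. -/
lemma aeval_derivative_charpoly_mulVec_eq_zero {F ι : Type*} [Field F] [Fintype ι] [DecidableEq ι]
    (A : Matrix ι ι F) (hA : A.IsSymm) (U : Submodule F (ι → F))
    (hU : ∀ u ∈ U, A.mulVecLin u ∈ U) (hiso : ∀ u ∈ U, ∀ w ∈ U, u ⬝ᵥ w = 0)
    {u : ι → F} (hu : u ∈ U) : (aeval A (derivative A.charpoly)) *ᵥ u = 0 := by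
  obtain ⟨g, hg⟩ := charpoly_restrict_sq_dvd A hA U hU hiso
  have hd : derivative A.charpoly = (2 * derivative (A.mulVecLin.restrict hU).charpoly * g +
      (A.mulVecLin.restrict hU).charpoly * derivative g) * (A.mulVecLin.restrict hU).charpoly := by
    rw [hg, derivative_mul, derivative_sq]
    simp only [map_ofNat]
    ring
  have h := aeval_mulVec_eq_aeval_restrict A U hU (derivative A.charpoly) ⟨u, hu⟩
  rw [h, hd, map_mul, LinearMap.aeval_self_charpoly, mul_zero]
  rfl

/-- Adding the all-one matrix does not change the action on vectors orthogonal to the all-one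
vector. -/
lemma charpoly_restrict_sq_dvd_add_ones {F ι : Type*} [Field F] [Fintype ι] [DecidableEq ι]
    (A : Matrix ι ι F) (hA : A.IsSymm) (U : Submodule F (ι → F))
    (hU : ∀ u ∈ U, A.mulVecLin u ∈ U) (hiso : ∀ u ∈ U, ∀ w ∈ U, u ⬝ᵥ w = 0)
    (hone : ∀ u ∈ U, (1 : ι → F) ⬝ᵥ u = 0) :
    (A.mulVecLin.restrict hU).charpoly ^ 2 ∣ (A + Matrix.of fun _ _ => 1).charpoly := by
  have hact : ∀ u ∈ U, (A + Matrix.of fun _ _ => 1).mulVecLin u = A.mulVecLin u := by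
    intro u hu
    have : (Matrix.of fun _ _ => 1 : Matrix ι ι F) *ᵥ u = 0 := by
      ext i; exact hone u hu
    simp [this]
  have hU' : ∀ u ∈ U, (A + Matrix.of fun _ _ => 1).mulVecLin u ∈ U := fun u hu =>
    (hact u hu).symm ▸ hU u hu
  have hr : (A + Matrix.of fun _ _ => 1).mulVecLin.restrict hU' = A.mulVecLin.restrict hU := by
    ext1 u
    exact Subtype.ext (hact u u.2)
  rw [← hr]
  refine charpoly_restrict_sq_dvd _ (hA.add (by ext; rfl)) U hU' hiso

/-- The greatest common divisor of the characteristic polynomials of `A` and `A + J` is not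
squarefree when a nonzero totally isotropic invariant subspace is orthogonal to the all-one
vector. -/
lemma not_squarefree_gcd_charpoly {F ι : Type*} [Field F] [DecidableEq F] [Fintype ι]
    [DecidableEq ι]
    (A : Matrix ι ι F) (hA : A.IsSymm) (U : Submodule F (ι → F)) (hne : U ≠ ⊥)
    (hU : ∀ u ∈ U, A.mulVecLin u ∈ U) (hiso : ∀ u ∈ U, ∀ w ∈ U, u ⬝ᵥ w = 0)
    (hone : ∀ u ∈ U, (1 : ι → F) ⬝ᵥ u = 0) :
    ¬ Squarefree (EuclideanDomain.gcd A.charpoly (A + Matrix.of fun _ _ => 1).charpoly) := by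
  intro hsq
  have h := hsq (A.mulVecLin.restrict hU).charpoly (by
    rw [← sq]
    exact EuclideanDomain.dvd_gcd (charpoly_restrict_sq_dvd A hA U hU hiso)
      (charpoly_restrict_sq_dvd_add_ones A hA U hU hiso hone))
  have h1 := (LinearMap.charpoly_monic (A.mulVecLin.restrict hU)).eq_one_of_isUnit h
  have h2 := LinearMap.charpoly_natDegree (A.mulVecLin.restrict hU)
  rw [h1, natDegree_one] at h2
  exact hne (Submodule.finrank_eq_zero.1 h2.symm)

/-! ### The characteristic polynomial of `A + J` -/

/-- The matrix determinant lemma, in terms of the adjugate. -/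
lemma det_sub_vecMulVec {S ι : Type*} [CommRing S] [IsDomain S] [Fintype ι] [DecidableEq ι]
    (N : Matrix ι ι S) (hN : N.det ≠ 0) (u v : ι → S) :
    (N - vecMulVec u v).det = N.det - v ⬝ᵥ (N.adjugate *ᵥ u) := by
  have hinj := IsFractionRing.injective S (FractionRing S)
  set φ : S →+* FractionRing S := algebraMap S (FractionRing S)
  apply hinj
  have hφ : ∀ M : Matrix ι ι S, φ M.det = (M.map φ).det := fun M => RingHom.map_det φ M
  have h0 : (N.map φ).det ≠ 0 := by
    rw [← hφ, Ne, map_eq_zero_iff φ hinj]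
    exact hN
  have h := Matrix.det_add_replicateCol_mul_replicateRow (ι := Unit) (isUnit_iff_ne_zero.2 h0)
    (fun i => -φ (u i)) (φ ∘ v)
  have h1 : (N - vecMulVec u v).map φ =
      N.map φ + replicateCol Unit (fun i => -φ (u i)) * replicateRow Unit (φ ∘ v) := by
    ext i j
    simp [Matrix.mul_apply, vecMulVec_apply, sub_eq_add_neg, Function.comp_def]
  have hadj : (N.map φ).adjugate = N.adjugate.map φ := (RingHom.map_adjugate φ N).symm
  change φ _ = φ _
  rw [hφ, h1, h, Matrix.det_unique (n := Unit), Matrix.inv_def, map_sub, hφ, Ring.inverse_eq_inv',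
    hadj]
  have h2 : φ (v ⬝ᵥ (N.adjugate *ᵥ u)) = (φ ∘ v) ⬝ᵥ (N.adjugate.map φ *ᵥ (φ ∘ u)) := by
    rw [RingHom.map_dotProduct]
    congr 1
    ext i
    exact RingHom.map_mulVec φ _ _ _
  have h3 : (replicateRow Unit (φ ∘ v) * ((N.map φ).det⁻¹ • N.adjugate.map φ) *
      replicateCol Unit (fun i => -φ (u i))) default default =
      -((N.map φ).det⁻¹ * ((φ ∘ v) ⬝ᵥ (N.adjugate.map φ *ᵥ (φ ∘ u)))) := by
    rw [Matrix.mul_assoc, Matrix.smul_mul, Matrix.mul_smul, Matrix.smul_apply, smul_eq_mul,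
      ← mul_neg]
    congr 1
    simp [Matrix.mul_apply, dotProduct, mulVec, Function.comp_def]
  rw [Matrix.add_apply, h3, ← h2, Matrix.one_apply_eq, mul_add, mul_neg, mul_inv_cancel_left₀ h0]
  ring

/-- The number `eᵀ Aᵏ e` of walks of length `k`. -/
def walkCount {R ι : Type*} [Semiring R] [Fintype ι] [DecidableEq ι] (A : Matrix ι ι R)
    (k : ℕ) : R :=
  1 ⬝ᵥ (A ^ k *ᵥ 1)

/-- The coefficients of `adj (x - A)` as a polynomial in `x` are polynomials in `A`. -/
lemma adjugate_charmatrix {R ι : Type*} [CommRing R] [IsDomain R] [Fintype ι] [DecidableEq ι]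
    (A : Matrix ι ι R) :
    A.charmatrix.adjugate = ∑ m ∈ Finset.range (Fintype.card ι + 1), C (A.charpoly.coeff m) •
      ∑ i ∈ Finset.range m, (X ^ i : R[X]) • (A ^ (m - 1 - i)).map C := by
  set x : Matrix ι ι R[X] := Matrix.scalar ι X
  set A' : Matrix ι ι R[X] := (C : R →+* R[X]).mapMatrix A
  have hpow : ∀ k, (A ^ k).map C = A' ^ k := fun k => map_pow (C : R →+* R[X]).mapMatrix A k
  have hx : ∀ (k : ℕ) (M : Matrix ι ι R[X]), (X ^ k : R[X]) • M = x ^ k * M := by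
    intro k M
    rw [← map_pow, Matrix.scalar_apply, Matrix.smul_eq_diagonal_mul]
  have hcomm : Commute x A' := Matrix.scalar_commute X (fun r => Commute.all _ r) A'
  set B := ∑ m ∈ Finset.range (Fintype.card ι + 1), C (A.charpoly.coeff m) •
      ∑ i ∈ Finset.range m, (X ^ i : R[X]) • (A ^ (m - 1 - i)).map C
  have hdeg : A.charpoly.natDegree = Fintype.card ι := A.charpoly_natDegree_eq_dim
  have hsum : ∑ m ∈ Finset.range (Fintype.card ι + 1), C (A.charpoly.coeff m) • x ^ m =
      A.charpoly • (1 : Matrix ι ι R[X]) := by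
    conv_rhs => rw [A.charpoly.as_sum_range_C_mul_X_pow, hdeg, Finset.sum_smul]
    refine Finset.sum_congr rfl fun m _ => ?_
    rw [mul_smul, hx, mul_one]
  have hzero : ∑ m ∈ Finset.range (Fintype.card ι + 1), C (A.charpoly.coeff m) • A' ^ m = 0 := by
    have h := A.aeval_self_charpoly
    rw [aeval_eq_sum_range, hdeg] at h
    have h' := congrArg (C : R →+* R[X]).mapMatrix h
    rw [map_sum, map_zero] at h'
    rw [← h']
    refine Finset.sum_congr rfl fun m _ => ?_
    rw [← hpow]
    ext1 i j
    simp
  have hB : A.charmatrix * B = A.charpoly • (1 : Matrix ι ι R[X]) := by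
    rw [Finset.mul_sum, ← hsum, ← sub_zero (∑ m ∈ _, _ • x ^ m), ← hzero, ← Finset.sum_sub_distrib]
    refine Finset.sum_congr rfl fun m _ => ?_
    rw [Matrix.mul_smul, ← smul_sub, ← hcomm.mul_geom_sum₂]
    simp only [hx, hpow]
    rfl
  have h1 : A.charpoly • B = A.charpoly • A.charmatrix.adjugate := by
    have := congrArg (A.charmatrix.adjugate * ·) hB
    simp only [← Matrix.mul_assoc, Matrix.adjugate_mul, Matrix.mul_smul, Matrix.mul_one,
      Matrix.smul_mul, Matrix.one_mul] at this
    exact this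
  ext1 i j
  have h2 := congrFun (congrFun h1 i) j
  exact (mul_left_cancel₀ A.charpoly_monic.ne_zero h2).symm

lemma charpoly_add_smul_ones {R ι : Type*} [CommRing R] [IsDomain R] [Fintype ι] [DecidableEq ι]
    (A : Matrix ι ι R) (t : R) :
    (A + t • Matrix.of fun _ _ => 1).charpoly = A.charpoly -
      C t * ∑ m ∈ Finset.range (Fintype.card ι + 1), C (A.charpoly.coeff m) *
        ∑ i ∈ Finset.range m, X ^ i * C (walkCount A (m - 1 - i)) := by
  have h1 : (A + t • Matrix.of fun _ _ => 1).charmatrix =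
      A.charmatrix - vecMulVec (fun _ => C t) 1 := by
    ext1 i j
    simp [charmatrix_apply]
    ring
  have hw : ∀ k, (1 : ι → R[X]) ⬝ᵥ ((A ^ k).map C *ᵥ 1) = C (walkCount A k) := by
    intro k
    simp [walkCount, dotProduct, mulVec]
  have ht : (fun _ => C t : ι → R[X]) = C t • 1 := by ext1 i; simp
  rw [Matrix.charpoly, h1, det_sub_vecMulVec _ A.charpoly_monic.ne_zero, adjugate_charmatrix,
    ht, mulVec_smul, dotProduct_smul, smul_eq_mul]
  congr 2
  simp only [Matrix.sum_mulVec, Matrix.smul_mulVec, dotProduct_sum, dotProduct_smul, hw, smul_eq_mul]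

lemma coeff_charpoly_add_smul_ones {R ι : Type*} [CommRing R] [IsDomain R] [Fintype ι]
    [DecidableEq ι] (A : Matrix ι ι R) (t : R) (i : ℕ) :
    (A + t • Matrix.of fun _ _ => 1).charpoly.coeff i = A.charpoly.coeff i -
      t * ∑ m ∈ Finset.range (Fintype.card ι + 1),
        if i < m then A.charpoly.coeff m * walkCount A (m - 1 - i) else 0 := by
  rw [charpoly_add_smul_ones, coeff_sub, coeff_C_mul, finsetSum_coeff]
  congr 2
  refine Finset.sum_congr rfl fun m _ => ?_
  rw [coeff_C_mul, finsetSum_coeff]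
  simp only [coeff_mul_C, coeff_X_pow, ite_mul, one_mul, zero_mul]
  rw [Finset.sum_ite_eq]
  simp

/-- Cayley–Hamilton for walk counts. -/
lemma sum_charpoly_coeff_mul_walkCount {R ι : Type*} [CommRing R] [Nontrivial R] [Fintype ι]
    [DecidableEq ι] (A : Matrix ι ι R) (k : ℕ) :
    ∑ m ∈ Finset.range (Fintype.card ι + 1), A.charpoly.coeff m * walkCount A (m + k) = 0 := by
  have h := A.aeval_self_charpoly
  rw [aeval_eq_sum_range, A.charpoly_natDegree_eq_dim] at h
  have h' := congrArg (fun M => (1 : ι → R) ⬝ᵥ (M * A ^ k) *ᵥ 1) h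
  simpa [Finset.sum_mul, Matrix.sum_mulVec, Matrix.smul_mulVec, dotProduct_sum, dotProduct_smul,
    ← pow_add, walkCount] using h'

/-- The walk counts are determined by the characteristic polynomials of `A` and of one
nontrivial perturbation `A + t J`. -/
lemma walkCount_eq_of_charpoly_eq {R ι : Type*} [CommRing R] [IsDomain R] [Fintype ι]
    [DecidableEq ι] (A B : Matrix ι ι R) (t : R) (ht : t ≠ 0) (h : A.charpoly = B.charpoly)
    (ht' : (A + t • Matrix.of fun _ _ => 1).charpoly = (B + t • Matrix.of fun _ _ => 1).charpoly)
    (k : ℕ) : walkCount A k = walkCount B k := by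
  have hlead : A.charpoly.coeff (Fintype.card ι) = 1 := by
    rw [← A.charpoly_natDegree_eq_dim]; exact A.charpoly_monic
  induction k using Nat.strong_induction_on with
  | _ k ih =>
    rcases lt_or_ge k (Fintype.card ι) with hk | hk
    · have h1 := congrArg (fun q => q.coeff (Fintype.card ι - 1 - k)) ht'
      simp only [coeff_charpoly_add_smul_ones, ← h, sub_right_inj] at h1
      have h2 := mul_left_cancel₀ ht h1
      rw [Finset.sum_range_succ, Finset.sum_range_succ, if_pos (by omega), if_pos (by omega),
        hlead, one_mul, one_mul,
        show Fintype.card ι - 1 - (Fintype.card ι - 1 - k) = k by omega] at h2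
      have h3 : ∀ m ∈ Finset.range (Fintype.card ι),
          (if Fintype.card ι - 1 - k < m then
            A.charpoly.coeff m * walkCount A (m - 1 - (Fintype.card ι - 1 - k)) else 0) =
          (if Fintype.card ι - 1 - k < m then
            A.charpoly.coeff m * walkCount B (m - 1 - (Fintype.card ι - 1 - k)) else 0) := by
        intro m hm
        rw [Finset.mem_range] at hm
        split_ifs with h4
        · rw [ih _ (by omega)]
        · rfl
      rw [Finset.sum_congr rfl h3] at h2
      exact add_left_cancel h2
    · have hA := sum_charpoly_coeff_mul_walkCount A (k - Fintype.card ι)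
      have hB := sum_charpoly_coeff_mul_walkCount B (k - Fintype.card ι)
      rw [← h, ← hA, Finset.sum_range_succ, Finset.sum_range_succ, hlead, one_mul, one_mul,
        Nat.add_sub_cancel' hk, Finset.sum_congr rfl fun m hm => by
          rw [← ih (m + (k - Fintype.card ι)) (by rw [Finset.mem_range] at hm; omega)]] at hB
      exact (add_left_cancel hB).symm

/-! ### The discriminant of a characteristic polynomial -/

/-- Both sides are, up to the same sign, the product of the values of `A.charpoly` at the roots of
`g`. -/
lemma det_aeval_eq_resultant {K ι : Type*} [Field K] [Fintype ι] [DecidableEq ι]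
    (A : Matrix ι ι K) (g : K[X]) (hg : g.Splits) :
    (aeval A g).det = resultant A.charpoly g := by
  let δ : K[X] →* K := Matrix.detMonoidHom.comp (aeval A : K[X] →ₐ[K] Matrix ι ι K).toMonoidHom
  have hδ : ∀ q, δ q = (aeval A q).det := fun _ => rfl
  have hC : ∀ a : K, δ (C a) = a ^ Fintype.card ι := by
    intro a
    rw [hδ, aeval_C, Algebra.algebraMap_eq_smul_one, Matrix.det_smul, Matrix.det_one, mul_one]
  have hX : ∀ μ : K, δ (X - C μ) = (-1) ^ Fintype.card ι * A.charpoly.eval μ := by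
    intro μ
    rw [hδ, eval_charpoly, ← Matrix.det_neg, neg_sub, map_sub, aeval_X, aeval_C]
    congr 1
  have hcard : g.roots.card = g.natDegree := hg.natDegree_eq_card_roots.symm
  have h1 : δ g = g.leadingCoeff ^ Fintype.card ι *
      (((-1) ^ Fintype.card ι) ^ g.natDegree * (g.roots.map fun μ => A.charpoly.eval μ).prod) := by
    conv_lhs => rw [hg.eq_prod_roots]
    rw [map_mul, hC, map_multiset_prod, Multiset.map_map]
    simp only [Function.comp_def, hX]
    rw [Multiset.prod_map_mul, Multiset.map_const', Multiset.prod_replicate, hcard]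
  rw [resultant_comm, resultant_eq_prod_eval _ _ _ le_rfl hg, ← hδ, h1,
    A.charpoly_natDegree_eq_dim, pow_mul]
  ring

lemma discr_charpoly_associated {ι : Type*} [Fintype ι] [DecidableEq ι] [Nonempty ι]
    (A : Matrix ι ι ℤ) :
    Associated A.charpoly.discr (aeval A (derivative A.charpoly)).det := by
  have hdeg : A.charpoly.natDegree = Fintype.card ι := A.charpoly_natDegree_eq_dim
  have hpos : 0 < A.charpoly.natDegree := hdeg ▸ Fintype.card_pos
  let φ := Int.castRingHom ℂ
  have hinj : Function.Injective φ := Int.cast_injective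
  have h1 : (aeval A (derivative A.charpoly)).det =
      resultant A.charpoly (derivative A.charpoly) A.charpoly.natDegree
        (A.charpoly.natDegree - 1) := by
    apply hinj
    have h2 : φ (aeval A (derivative A.charpoly)).det =
        (aeval (A.map φ) (derivative (A.map φ).charpoly)).det := by
      rw [RingHom.map_det, charpoly_map, derivative_map]
      congr 1
      have := map_aeval_eq_aeval_map (R := ℤ) (S := Matrix ι ι ℤ) (T := ℂ) (U := Matrix ι ι ℂ)
        (φ := φ) (ψ := φ.mapMatrix) (by ext; simp) (derivative A.charpoly) A
      exact this
    rw [h2, det_aeval_eq_resultant _ _ (IsAlgClosed.splits _), natDegree_derivative,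
      ← resultant_map_map, charpoly_map, derivative_map, A.charpoly_monic.natDegree_map]
  rw [h1, resultant_deriv (natDegree_pos_iff_degree_pos.1 hpos), A.charpoly_monic.leadingCoeff,
    mul_one]
  exact (associated_unit_mul_left _ _ ((isUnit_one.neg).pow _)).symm

/-! ### Cyclic subspaces -/

lemma dotProduct_pow_mulVec {R ι : Type*} [CommRing R] [Fintype ι] [DecidableEq ι]
    {A : Matrix ι ι R} (hA : A.IsSymm) (x y : ι → R) (i j : ℕ) :
    (A ^ i *ᵥ x) ⬝ᵥ (A ^ j *ᵥ y) = x ⬝ᵥ (A ^ (i + j) *ᵥ y) := by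
  rw [pow_add, ← Matrix.mulVec_mulVec, Matrix.dotProduct_mulVec x, ← Matrix.mulVec_transpose,
    (hA.pow i).eq]

/-- The smallest invariant subspace containing `v`. -/
def cyclicSubspace {F ι : Type*} [Field F] [Fintype ι] [DecidableEq ι] (A : Matrix ι ι F)
    (v : ι → F) : Submodule F (ι → F) :=
  Submodule.span F (Set.range fun k : ℕ => A ^ k *ᵥ v)

section Cyclic

variable {F ι : Type*} [Field F] [Fintype ι] [DecidableEq ι] (A : Matrix ι ι F) (v : ι → F)

lemma self_mem_cyclicSubspace : v ∈ cyclicSubspace A v :=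
  Submodule.subset_span ⟨0, by simp⟩

lemma mulVecLin_mem_cyclicSubspace : ∀ u ∈ cyclicSubspace A v,
    A.mulVecLin u ∈ cyclicSubspace A v := by
  intro u hu
  induction hu using Submodule.span_induction with
  | mem x h =>
    obtain ⟨k, rfl⟩ := h
    exact Submodule.subset_span ⟨k + 1, by simp [pow_succ', Matrix.mulVec_mulVec]⟩
  | zero => simp
  | add x y _ _ hx hy => rw [map_add]; exact add_mem hx hy
  | smul a x _ hx => rw [map_smul]; exact Submodule.smul_mem _ a hx

lemma dotProduct_eq_zero_of_mem_cyclicSubspace (w : ι → F) (hw : ∀ k, w ⬝ᵥ (A ^ k *ᵥ v) = 0) :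
    ∀ u ∈ cyclicSubspace A v, w ⬝ᵥ u = 0 := by
  intro u hu
  induction hu using Submodule.span_induction with
  | mem x h => obtain ⟨k, rfl⟩ := h; exact hw k
  | zero => simp
  | add x y _ _ hx hy => rw [dotProduct_add, hx, hy, add_zero]
  | smul a x _ hx => rw [dotProduct_smul, hx, smul_zero]

lemma cyclicSubspace_isotropic (hA : A.IsSymm) (hv : ∀ k, v ⬝ᵥ (A ^ k *ᵥ v) = 0) :
    ∀ u ∈ cyclicSubspace A v, ∀ w ∈ cyclicSubspace A v, u ⬝ᵥ w = 0 := by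
  intro u hu
  refine dotProduct_eq_zero_of_mem_cyclicSubspace A v u fun k => ?_
  rw [dotProduct_comm]
  refine dotProduct_eq_zero_of_mem_cyclicSubspace A v _ (fun j => ?_) u hu
  rw [dotProduct_pow_mulVec hA]
  exact hv _

end Cyclic

/-! ### Reduction modulo a prime -/

section Reduction

variable {ι : Type*} (p : ℕ)

/-- Reduction of an integral vector modulo `p`. -/
def redVec (v : ι → ℤ) : ι → ZMod p := fun i => (v i : ZMod p)

/-- Reduction of an integral matrix modulo `p`. -/
def redMat (A : Matrix ι ι ℤ) : Matrix ι ι (ZMod p) := A.map (Int.castRingHom (ZMod p))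

lemma redVec_mulVec [Fintype ι] (A : Matrix ι ι ℤ) (v : ι → ℤ) :
    redVec p (A *ᵥ v) = redMat p A *ᵥ redVec p v := by
  ext i; exact RingHom.map_mulVec (Int.castRingHom (ZMod p)) A v i

lemma redVec_dotProduct [Fintype ι] (v w : ι → ℤ) :
    ((v ⬝ᵥ w : ℤ) : ZMod p) = redVec p v ⬝ᵥ redVec p w :=
  RingHom.map_dotProduct (Int.castRingHom (ZMod p)) v w

lemma redMat_pow [Fintype ι] [DecidableEq ι] (A : Matrix ι ι ℤ) (k : ℕ) :
    redMat p (A ^ k) = redMat p A ^ k :=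
  map_pow (Int.castRingHom (ZMod p)).mapMatrix A k

lemma charpoly_redMat [Fintype ι] [DecidableEq ι] (A : Matrix ι ι ℤ) :
    (redMat p A).charpoly = A.charpoly.map (Int.castRingHom (ZMod p)) := charpoly_map _ _

lemma redMat_aeval [Fintype ι] [DecidableEq ι] (A : Matrix ι ι ℤ) (q : ℤ[X]) :
    redMat p (aeval A q) = aeval (redMat p A) (q.map (Int.castRingHom (ZMod p))) :=
  map_aeval_eq_aeval_map (R := ℤ) (S := Matrix ι ι ℤ) (T := ZMod p) (U := Matrix ι ι (ZMod p))
    (φ := Int.castRingHom (ZMod p)) (ψ := (Int.castRingHom (ZMod p)).mapMatrix)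
    (by ext; simp) q A

lemma redVec_eq_zero_iff (v : ι → ℤ) : redVec p v = 0 ↔ ∀ i, (p : ℤ) ∣ v i := by
  rw [funext_iff]
  exact forall_congr' fun i => ZMod.intCast_zmod_eq_zero_iff_dvd _ _

end Reduction

/-! ### Isotropic vectors modulo a prime -/

/-- An integral vector `v`, nonzero modulo `p`, such that modulo `p` the vectors `Aᵏ v` are
orthogonal to the all-one vector and modulo `p ^ 2` they are orthogonal to `v`. -/
structure IsWalkIsotropic {ι : Type*} [Fintype ι] [DecidableEq ι] (p : ℕ) (A : Matrix ι ι ℤ)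
    (v : ι → ℤ) : Prop where
  redVec_ne_zero : redVec p v ≠ 0
  sq_dvd : ∀ k, (p : ℤ) ^ 2 ∣ v ⬝ᵥ (A ^ k *ᵥ v)
  dvd : ∀ k, (p : ℤ) ∣ 1 ⬝ᵥ (A ^ k *ᵥ v)

lemma redMat_isSymm {ι : Type*} {p : ℕ} {A : Matrix ι ι ℤ} (hA : A.IsSymm) :
    (redMat p A).IsSymm := hA.map _

lemma Matrix.IsSymm.aeval {R ι : Type*} [CommRing R] [Fintype ι] [DecidableEq ι]
    {A : Matrix ι ι R} (hA : A.IsSymm) (q : R[X]) : (Polynomial.aeval A q).IsSymm := by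
  rw [Matrix.IsSymm, aeval_eq_sum_range, Matrix.transpose_sum]
  exact Finset.sum_congr rfl fun k _ => by rw [Matrix.transpose_smul, (hA.pow k).eq]

/-- If the cyclic subspace of `v` is totally isotropic modulo `p`, then `χ'(A) v ≡ 0` modulo `p`,
where `χ` is the characteristic polynomial of `A`. -/
lemma dvd_aeval_derivative_charpoly_mulVec {ι : Type*} [Fintype ι] [DecidableEq ι] {p : ℕ}
    [Fact p.Prime] {A : Matrix ι ι ℤ} (hA : A.IsSymm) {v : ι → ℤ}
    (hv : ∀ k, (p : ℤ) ∣ v ⬝ᵥ (A ^ k *ᵥ v)) (i : ι) :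
    (p : ℤ) ∣ (aeval A (derivative A.charpoly) *ᵥ v) i := by
  refine (redVec_eq_zero_iff p _).1 ?_ i
  rw [redVec_mulVec, redMat_aeval, ← derivative_map, ← charpoly_redMat]
  refine aeval_derivative_charpoly_mulVec_eq_zero _ (redMat_isSymm hA) _
    (mulVecLin_mem_cyclicSubspace _ _)
    (cyclicSubspace_isotropic _ _ (redMat_isSymm hA) fun k => ?_) (self_mem_cyclicSubspace _ _)
  rw [← redMat_pow, ← redVec_mulVec, ← redVec_dotProduct, ZMod.intCast_zmod_eq_zero_iff_dvd]
  exact hv k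

namespace IsWalkIsotropic

variable {ι : Type*} [Fintype ι] [DecidableEq ι] {p : ℕ}
  {A : Matrix ι ι ℤ} {v : ι → ℤ}

lemma exists_not_dvd (hv : IsWalkIsotropic p A v) : ∃ i, ¬ (p : ℤ) ∣ v i := by
  by_contra! h
  exact hv.redVec_ne_zero ((redVec_eq_zero_iff p v).2 h)

lemma sq_dvd_aeval (hv : IsWalkIsotropic p A v) (q : ℤ[X]) :
    (p : ℤ) ^ 2 ∣ v ⬝ᵥ (aeval A q *ᵥ v) := by
  rw [aeval_eq_sum_range, Matrix.sum_mulVec, dotProduct_sum]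
  refine Finset.dvd_sum fun k _ => ?_
  rw [Matrix.smul_mulVec, dotProduct_smul, smul_eq_mul]
  exact (hv.sq_dvd k).mul_left _

lemma dotProduct_redVec (hv : IsWalkIsotropic p A v) (k : ℕ) :
    redVec p v ⬝ᵥ (redMat p A ^ k *ᵥ redVec p v) = 0 := by
  rw [← redMat_pow, ← redVec_mulVec, ← redVec_dotProduct, ZMod.intCast_zmod_eq_zero_iff_dvd]
  exact (Dvd.intro_left _ (sq (p : ℤ)).symm).trans (hv.sq_dvd k)

lemma one_dotProduct_redVec (hv : IsWalkIsotropic p A v) (k : ℕ) :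
    1 ⬝ᵥ (redMat p A ^ k *ᵥ redVec p v) = 0 := by
  have h1 : (1 : ι → ZMod p) = redVec p 1 := by ext; simp [redVec]
  rw [← redMat_pow, ← redVec_mulVec, h1, ← redVec_dotProduct, ZMod.intCast_zmod_eq_zero_iff_dvd]
  exact hv.dvd k

/-- `χ'(A)` is a symmetric matrix whose determinant is the discriminant up to sign, and `v` is in
its kernel modulo `p`. -/
lemma sq_dvd_discr [hp : Fact p.Prime] (hA : A.IsSymm) (hv : IsWalkIsotropic p A v) :
    (p : ℤ) ^ 2 ∣ A.charpoly.discr := by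
  obtain ⟨i, hi⟩ := hv.exists_not_dvd
  have : Nonempty ι := ⟨i⟩
  refine (discr_charpoly_associated A).dvd_iff_dvd_right.2 ?_
  refine sq_dvd_det_of_isSymm (Nat.prime_iff_prime_int.1 hp.out) _ (hA.aeval _) v i hi
    (dvd_aeval_derivative_charpoly_mulVec hA fun k => ?_) (hv.sq_dvd_aeval _)
  exact (Dvd.intro_left _ (sq (p : ℤ)).symm).trans (hv.sq_dvd k)

lemma not_squarefree_gcd [Fact p.Prime] (hA : A.IsSymm) (hv : IsWalkIsotropic p A v)
    [DecidableEq (ZMod p)] :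
    ¬ Squarefree (EuclideanDomain.gcd (redMat p A).charpoly
      (redMat p A + Matrix.of fun _ _ => 1).charpoly) := by
  refine not_squarefree_gcd_charpoly _ (redMat_isSymm hA) (cyclicSubspace (redMat p A) (redVec p v))
    (fun h => hv.redVec_ne_zero ?_) (mulVecLin_mem_cyclicSubspace _ _)
    (cyclicSubspace_isotropic _ _ (redMat_isSymm hA) hv.dotProduct_redVec)
    (dotProduct_eq_zero_of_mem_cyclicSubspace _ _ _ hv.one_dotProduct_redVec)
  have := self_mem_cyclicSubspace (redMat p A) (redVec p v)
  rwa [h, Submodule.mem_bot] at this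

end IsWalkIsotropic

/-! ### The determinant of the walk matrix -/

/-- The matrix with columns `e, Ae, …, Aⁿ⁻¹e`. -/
def walkMat {R : Type*} [Semiring R] {n : ℕ} (A : Matrix (Fin n) (Fin n) R) :
    Matrix (Fin n) (Fin n) R :=
  Matrix.of fun i j => (A ^ (j : ℕ) *ᵥ 1) i

section WalkMat

variable {R : Type*} [CommRing R] {n : ℕ} {A : Matrix (Fin n) (Fin n) R}

lemma walkMat_transpose_mulVec (hA : A.IsSymm) (v : Fin n → R) (i : Fin n) :
    ((walkMat A)ᵀ *ᵥ v) i = 1 ⬝ᵥ (A ^ (i : ℕ) *ᵥ v) := by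
  have h := dotProduct_pow_mulVec hA 1 v i 0
  rw [add_zero, pow_zero, Matrix.one_mulVec] at h
  exact h

lemma walkMat_gram (hA : A.IsSymm) (i j : Fin n) :
    ((walkMat A)ᵀ * walkMat A) i j = walkCount A (i + j) :=
  dotProduct_pow_mulVec hA 1 1 i j

/-- Replacing `A` by `A - c` changes the walk matrix by a unitriangular factor. -/
lemma det_walkMat_sub_scalar [Nontrivial R] (c : R) :
    (walkMat (A - Matrix.scalar (Fin n) c)).det = (walkMat A).det := by
  have h : walkMat (A - Matrix.scalar (Fin n) c) =
      walkMat A * Matrix.of fun i j : Fin n => ((X - C c) ^ (j : ℕ) : R[X]).coeff i := by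
    ext i j
    have h1 : (A - Matrix.scalar (Fin n) c) ^ (j : ℕ) = aeval A ((X - C c) ^ (j : ℕ)) := by
      rw [map_pow, map_sub, aeval_X, aeval_C]
      rfl
    have hdeg : ((X - C c) ^ (j : ℕ) : R[X]).natDegree < n := by
      rw [(monic_X_sub_C c).natDegree_pow, natDegree_X_sub_C, mul_one]; exact j.2
    rw [walkMat, Matrix.of_apply, h1, aeval_eq_sum_range' hdeg, Matrix.sum_mulVec,
      Finset.sum_range, Matrix.mul_apply, Finset.sum_apply]
    refine Finset.sum_congr rfl fun k _ => ?_
    rw [Matrix.smul_mulVec, Pi.smul_apply, smul_eq_mul, mul_comm]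
    rfl
  rw [h, Matrix.det_mul, Matrix.det_matrixOfPolynomials, mul_one]
  · intro i; rw [(monic_X_sub_C c).natDegree_pow, natDegree_X_sub_C, mul_one]
  · intro i; exact (monic_X_sub_C c).pow _

end WalkMat

/-- Suppose that the characteristic polynomials of `A` and of `A + J` both have constant coefficient
divisible by `p ^ 2` and linear coefficient divisible by `p`. With `c` the coefficients of the
former, the Gram matrix `Wᵀ W` sends `(c₁, c₂, …, cₙ)` to a multiple of `p ^ 2` and
`(c₂, …, cₙ, 0)` to a multiple of `p`, so `p ^ 3` divides `det W ^ 2`. -/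
lemma sq_dvd_det_walkMat_of_coeff {n : ℕ} (hn : 2 ≤ n) {p : ℕ} [hp : Fact p.Prime]
    {A : Matrix (Fin n) (Fin n) ℤ} (hA : A.IsSymm)
    (h0 : (p : ℤ) ^ 2 ∣ A.charpoly.coeff 0) (h1 : (p : ℤ) ∣ A.charpoly.coeff 1)
    (h0' : (p : ℤ) ^ 2 ∣ (A + Matrix.of fun _ _ => 1).charpoly.coeff 0)
    (h1' : (p : ℤ) ∣ (A + Matrix.of fun _ _ => 1).charpoly.coeff 1) :
    (p : ℤ) ^ 2 ∣ (walkMat A).det := by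
  set c := A.charpoly.coeff with hc
  set h := walkCount A
  have hcard : Fintype.card (Fin n) = n := Fintype.card_fin n
  have hlead : c n = 1 := by
    have := A.charpoly_monic
    rwa [Monic, leadingCoeff, A.charpoly_natDegree_eq_dim, hcard] at this
  have hbig : c (n + 1) = 0 :=
    coeff_eq_zero_of_natDegree_lt (by rw [A.charpoly_natDegree_eq_dim, hcard]; omega)
  have hJ : ∀ i, (A + Matrix.of fun _ _ => 1).charpoly.coeff i = c i -
      ∑ m ∈ Finset.range (n + 2), if i < m then c m * h (m - 1 - i) else 0 := by
    intro i
    have := coeff_charpoly_add_smul_ones A 1 i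
    rw [one_smul, one_mul, hcard] at this
    rw [this, Finset.sum_range_succ _ (n + 1), hbig]
    simp [hc, h]
  have hCH : ∀ k, ∑ m ∈ Finset.range (n + 2), c m * h (m + k) = 0 := by
    intro k
    have := sum_charpoly_coeff_mul_walkCount A k
    rw [hcard] at this
    rw [Finset.sum_range_succ, hbig, this, zero_mul, zero_add]
  have hN0 : (p : ℤ) ^ 2 ∣ ∑ j ∈ Finset.range (n + 1), c (j + 1) * h j := by
    have := (dvd_sub_right h0).1 (hJ 0 ▸ h0')
    rw [Finset.sum_range_succ'] at this
    simpa using this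
  have hN1 : (p : ℤ) ∣ ∑ j ∈ Finset.range n, c (j + 2) * h j := by
    have := (dvd_sub_right h1).1 (hJ 1 ▸ h1')
    rw [Finset.sum_range_succ', Finset.sum_range_succ'] at this
    simpa using this
  let a : Fin n → ℤ := fun j => c (j + 1)
  let b : Fin n → ℤ := fun j => c (j + 2)
  set G := (walkMat A)ᵀ * walkMat A with hG
  have hGa : ∀ i, (G *ᵥ a) i = ∑ j ∈ Finset.range (n + 1), c (j + 1) * h (i + j) := by
    intro i
    rw [Finset.sum_range_succ, hbig, zero_mul, add_zero, Finset.sum_range, Matrix.mulVec,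
      dotProduct]
    refine Finset.sum_congr rfl fun j _ => ?_
    rw [hG, walkMat_gram hA, mul_comm]
  have hGb : ∀ i, (G *ᵥ b) i = ∑ j ∈ Finset.range n, c (j + 2) * h (i + j) := by
    intro i
    rw [Finset.sum_range, Matrix.mulVec, dotProduct]
    refine Finset.sum_congr rfl fun j _ => ?_
    rw [hG, walkMat_gram hA, mul_comm]
  have hp1 : (p : ℤ) ∣ (p : ℤ) ^ 2 := Dvd.intro_left _ (sq (p : ℤ)).symm
  have hda : ∀ i, (p : ℤ) ^ 2 ∣ (G *ᵥ a) i := by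
    rintro ⟨i, hi⟩
    rw [hGa]
    rcases i with _ | k
    · simpa using hN0
    · have := hCH k
      rw [Finset.sum_range_succ'] at this
      rw [Finset.sum_congr rfl fun j _ => by rw [show k + 1 + j = j + 1 + k by ring],
        eq_neg_of_add_eq_zero_left this]
      exact (h0.mul_right _).neg_right
  have hdb : ∀ i, (p : ℤ) ∣ (G *ᵥ b) i := by
    rintro ⟨i, hi⟩
    rw [hGb]
    rcases i with _ | _ | k
    · simpa using hN1
    · have h2 := hp1.trans hN0
      rw [Finset.sum_range_succ'] at h2
      have h3 := (dvd_add_left (h1.mul_right (h 0))).1 h2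
      simpa [add_comm 1] using h3
    · have := hCH k
      rw [Finset.sum_range_succ', Finset.sum_range_succ', add_assoc] at this
      rw [Finset.sum_congr rfl fun j _ => by
          rw [show k + 1 + 1 + j = j + 1 + 1 + k by ring],
        eq_neg_of_add_eq_zero_left this]
      exact ((h1.mul_right _).add ((hp1.trans h0).mul_right _)).neg_right
  -- The last two coordinates of `a` and `b` are `*, 1` and `1, 0`.
  have hind : LinearIndependent (ZMod p) ![redVec p a, redVec p b] := by
    rw [LinearIndependent.pair_iff]
    intro s t hst
    have e1 := congrFun hst ⟨n - 1, by omega⟩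
    have e2 := congrFun hst ⟨n - 2, by omega⟩
    have i1 : n - 1 + 1 = n := by omega
    have i2 : n - 1 + 2 = n + 1 := by omega
    have i3 : n - 2 + 2 = n := by omega
    simp [redVec, a, b, i1, i2, hlead, hbig] at e1
    simp [redVec, a, b, i3, hlead, e1] at e2
    exact ⟨e1, e2⟩
  have hG3 := pow_sum_dvd_det G ![a, b] (by
      convert hind using 1
      ext k i
      fin_cases k <;> rfl) ![2, 1] (by
    intro k i
    fin_cases k
    · exact hda i
    · simpa using hdb i)
  have hpp : Prime (p : ℤ) := Nat.prime_iff_prime_int.1 hp.out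
  rw [hG, Matrix.det_mul, Matrix.det_transpose, ← sq, Fin.sum_univ_two] at hG3
  change (p : ℤ) ^ 3 ∣ _ at hG3
  obtain ⟨q, hq⟩ := hpp.dvd_of_dvd_pow ((dvd_pow_self (p : ℤ) three_ne_zero).trans hG3)
  rw [hq, mul_pow, pow_succ (p : ℤ) 2] at hG3
  have hpq := hpp.dvd_of_dvd_pow (Int.dvd_of_mul_dvd_mul_left (pow_ne_zero 2 hpp.ne_zero) hG3)
  rw [hq, sq]
  exact mul_dvd_mul_left _ hpq

/-- The constant coefficient is the determinant up to sign. For the linear one, `M` is zero modulo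
`p` on the isotropic line spanned by `v`, so `x ^ 2` divides its characteristic polynomial. -/
lemma charpoly_coeff_of_mulVec_dvd {ι : Type*} [Fintype ι] [DecidableEq ι] {p : ℕ}
    [hp : Fact p.Prime] {M : Matrix ι ι ℤ} (hM : M.IsSymm) {v : ι → ℤ} (hv : redVec p v ≠ 0)
    (hvv : (p : ℤ) ∣ v ⬝ᵥ v) (hMv : ∀ i, (p : ℤ) ∣ (M *ᵥ v) i)
    (hvMv : (p : ℤ) ^ 2 ∣ v ⬝ᵥ M *ᵥ v) :
    (p : ℤ) ^ 2 ∣ M.charpoly.coeff 0 ∧ (p : ℤ) ∣ M.charpoly.coeff 1 := by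
  constructor
  · obtain ⟨i, hi⟩ : ∃ i, ¬ (p : ℤ) ∣ v i := by
      by_contra! h
      exact hv ((redVec_eq_zero_iff p v).2 h)
    have h := sq_dvd_det_of_isSymm (Nat.prime_iff_prime_int.1 hp.out) M hM v i hi hMv hvMv
    rw [Matrix.det_eq_sign_charpoly_coeff] at h
    exact ((isUnit_one.neg).pow _).dvd_mul_left.1 h
  · have hz : redMat p M *ᵥ redVec p v = 0 := by
      rw [← redVec_mulVec]; exact (redVec_eq_zero_iff p _).2 hMv
    have hpow : ∀ k, redVec p v ⬝ᵥ (redMat p M ^ k *ᵥ redVec p v) = 0 := by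
      rintro (_ | k)
      · rw [pow_zero, Matrix.one_mulVec, ← redVec_dotProduct, ZMod.intCast_zmod_eq_zero_iff_dvd]
        exact hvv
      · rw [pow_succ, ← Matrix.mulVec_mulVec, hz]; simp
    have hU := mulVecLin_mem_cyclicSubspace (redMat p M) (redVec p v)
    have h := charpoly_restrict_sq_dvd (redMat p M) (redMat_isSymm hM) _ hU
      (cyclicSubspace_isotropic _ _ (redMat_isSymm hM) hpow)
    have hr : (redMat p M).mulVecLin.restrict hU = 0 := by
      ext1 u
      refine Subtype.ext ?_
      change redMat p M *ᵥ (u : ι → ZMod p) = 0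
      have hrow : ∀ u ∈ cyclicSubspace (redMat p M) (redVec p v), redMat p M *ᵥ u = 0 := by
        intro u hu
        ext i
        refine dotProduct_eq_zero_of_mem_cyclicSubspace _ _ (redMat p M i) (fun k => ?_) u hu
        have : (redMat p M *ᵥ (redMat p M ^ k *ᵥ redVec p v)) i = 0 := by
          rw [Matrix.mulVec_mulVec, ← pow_succ', pow_succ, ← Matrix.mulVec_mulVec, hz]; simp
        exact this
      exact hrow u u.2
    have hfin : Module.finrank (ZMod p) (cyclicSubspace (redMat p M) (redVec p v)) ≠ 0 := by
      rw [Ne, Submodule.finrank_eq_zero]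
      intro hb
      have := self_mem_cyclicSubspace (redMat p M) (redVec p v)
      rw [hb, Submodule.mem_bot] at this
      exact hv this
    rw [hr, LinearMap.charpoly_zero, ← pow_mul] at h
    have h2 := (X_pow_dvd_iff.1 h) 1 (by omega)
    rwa [charpoly_redMat, coeff_map, eq_intCast, ZMod.intCast_zmod_eq_zero_iff_dvd] at h2

/-- A walk-isotropic vector modulo `p` forces `p ^ 2 ∣ det W`. If `v` and `Av` are independent
modulo `p`, they span a plane in the kernel of `Wᵀ`; otherwise `v` is an eigenvector modulo `p`,
and the matrix can be shifted to make the eigenvalue zero. -/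
lemma IsWalkIsotropic.sq_dvd_det_walkMat {n : ℕ} {p : ℕ} [hp : Fact p.Prime]
    {A : Matrix (Fin n) (Fin n) ℤ} (hA : A.IsSymm) {v : Fin n → ℤ} (hv : IsWalkIsotropic p A v) :
    (p : ℤ) ^ 2 ∣ (walkMat A).det := by
  have hpp : Prime (p : ℤ) := Nat.prime_iff_prime_int.1 hp.out
  have hp1 : (p : ℤ) ∣ (p : ℤ) ^ 2 := Dvd.intro_left _ (sq (p : ℤ)).symm
  by_cases hind : LinearIndependent (ZMod p) ![redVec p v, redVec p (A *ᵥ v)]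
  · have h := pow_sum_dvd_det (p := p) (walkMat A)ᵀ ![v, A *ᵥ v] (by
      convert hind using 1
      ext k i
      fin_cases k <;> rfl) (fun _ => 1) (by
      intro k i
      rw [walkMat_transpose_mulVec hA, pow_one]
      fin_cases k
      · exact hv.dvd i
      · have := hv.dvd (i + 1)
        rwa [pow_succ, ← Matrix.mulVec_mulVec] at this)
    rwa [Matrix.det_transpose, Finset.sum_const, Finset.card_univ, Fintype.card_fin, smul_eq_mul,
      mul_one] at h
  · rw [LinearIndependent.pair_iff' hv.redVec_ne_zero] at hind
    push Not at hind
    obtain ⟨a, ha⟩ := hind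
    obtain ⟨i₀, hi₀⟩ := hv.exists_not_dvd
    have hn : 2 ≤ n := by
      by_contra hn
      have h1 := hv.dvd 0
      rw [pow_zero, Matrix.one_mulVec, one_dotProduct, Finset.sum_eq_single i₀] at h1
      · exact hi₀ h1
      · intro b _ hb
        exact absurd (Fin.ext (by omega)) hb
      · simp
    obtain ⟨c, hc⟩ : ∃ c : ℤ, (c : ZMod p) = a := ⟨a.val, by simp⟩
    have hvv : (p : ℤ) ^ 2 ∣ v ⬝ᵥ v := by simpa using hv.sq_dvd 0
    have hvA : (p : ℤ) ^ 2 ∣ v ⬝ᵥ (A *ᵥ v) := by simpa using hv.sq_dvd 1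
    have hv1 : (p : ℤ) ∣ 1 ⬝ᵥ v := by simpa using hv.dvd 0
    have hcv : Matrix.scalar (Fin n) c *ᵥ v = c • v := by
      ext i
      simp
    set M := A - Matrix.scalar (Fin n) c with hMdef
    have hM : M.IsSymm := hA.sub (by simp [Matrix.IsSymm])
    have hMv' : M *ᵥ v = A *ᵥ v - c • v := by rw [hMdef, Matrix.sub_mulVec, hcv]
    have hMv : ∀ i, (p : ℤ) ∣ (M *ᵥ v) i := by
      refine (redVec_eq_zero_iff p _).1 ?_
      ext i
      have := congrFun ha i
      rw [hMv']
      simp only [redVec, Pi.smul_apply, smul_eq_mul] at this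
      simp [redVec, ← this, hc]
    have hvMv : (p : ℤ) ^ 2 ∣ v ⬝ᵥ M *ᵥ v := by
      rw [hMv', dotProduct_sub, dotProduct_smul]
      exact hvA.sub (hvv.mul_left _)
    have hJv : (Matrix.of fun _ _ => 1 : Matrix (Fin n) (Fin n) ℤ) *ᵥ v = (1 ⬝ᵥ v) • 1 := by
      ext i
      simp [Matrix.mulVec, dotProduct]
    obtain ⟨h0, h1⟩ := charpoly_coeff_of_mulVec_dvd hM hv.redVec_ne_zero (hp1.trans hvv) hMv hvMv
    obtain ⟨h0', h1'⟩ := charpoly_coeff_of_mulVec_dvd (M := M + Matrix.of fun _ _ => 1)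
      (hM.add (by ext; rfl)) hv.redVec_ne_zero (hp1.trans hvv) (by
        intro i
        rw [Matrix.add_mulVec, hJv]
        exact (hMv i).add (hv1.mul_right _)) (by
        rw [Matrix.add_mulVec, hJv, dotProduct_add, dotProduct_smul, dotProduct_comm v 1,
          smul_eq_mul, ← sq]
        exact hvMv.add (pow_dvd_pow_of_dvd hv1 2))
    have := sq_dvd_det_walkMat_of_coeff hn hM h0 h1 h0' h1'
    rwa [hMdef, det_walkMat_sub_scalar] at this

/-! ### The prime two -/

/-- A quadratic form over `𝔽₂` is determined by the diagonal, as the off-diagonal terms cancel. -/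
lemma dotProduct_mulVec_self_eq_diag {n : ℕ} {H : Matrix (Fin n) (Fin n) (ZMod 2)}
    (hH : H.IsSymm) (x : Fin n → ZMod 2) : x ⬝ᵥ (H *ᵥ x) = ∑ i, x i * H i i := by
  have h := GenSpec.dotProduct_mulVec_self_mod_two (A := H - Matrix.diagonal fun i => H i i)
    (by rw [Matrix.transpose_sub, hH.eq, Matrix.diagonal_transpose]) (by simp) x
  rw [Matrix.sub_mulVec, dotProduct_sub, sub_eq_zero] at h
  rw [h]
  refine Finset.sum_congr rfl fun i _ => ?_
  rw [Matrix.mulVec_diagonal]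
  have hsq : ∀ a b : ZMod 2, a * (b * a) = a * b := by decide
  exact hsq _ _

section Two

variable {n : ℕ} {A : Matrix (Fin n) (Fin n) ℤ}

lemma two_dvd_walkCount (hA : A.IsSymm) (hd : ∀ i, A i i = 0) {k : ℕ} (hk : n % 2 ≤ k) :
    (2 : ℤ) ∣ walkCount A k := by
  have hcast : ((walkCount A k : ℤ) : ZMod 2) = 1 ⬝ᵥ (redMat 2 A ^ k *ᵥ 1) := by
    have h1 : (1 : Fin n → ZMod 2) = redVec 2 1 := by ext; simp [redVec]
    rw [walkCount, redVec_dotProduct, redVec_mulVec, redMat_pow, h1]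
  refine (ZMod.intCast_zmod_eq_zero_iff_dvd _ 2).1 ?_
  rw [hcast]
  rcases Nat.eq_zero_or_pos k with rfl | hk'
  · have : ((n : ℕ) : ZMod 2) = 0 := by
      rw [ZMod.natCast_eq_zero_iff]; omega
    simpa using this
  · exact GenSpec.walk_sum_mod_two (redMat_isSymm hA) (by intro i; simp [redMat, hd]) k hk'

/-- The Gram matrix `Wᵀ W` after dividing by two every column all of whose entries are even, that
is, every column except the first one when `n` is odd. -/
def halfGram (A : Matrix (Fin n) (Fin n) ℤ) : Matrix (Fin n) (Fin n) ℤ :=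
  Matrix.of fun k j => if (j : ℕ) < n % 2 then walkCount A (k + j) else walkCount A (k + j) / 2

lemma det_walkMat_sq (hA : A.IsSymm) (hd : ∀ i, A i i = 0) :
    (walkMat A).det ^ 2 = (halfGram A).det * (2 ^ (n / 2)) ^ 2 := by
  have h : (walkMat A)ᵀ * walkMat A =
      halfGram A * Matrix.diagonal fun j : Fin n => if (j : ℕ) < n % 2 then 1 else 2 := by
    ext k j
    rw [walkMat_gram hA, Matrix.mul_diagonal, halfGram, Matrix.of_apply]
    split_ifs with hj
    · rw [mul_one]
    · rw [Int.ediv_mul_cancel (two_dvd_walkCount hA hd (by omega))]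
  have hdiag : ∏ j : Fin n, (if (j : ℕ) < n % 2 then 1 else 2 : ℤ) = (2 ^ (n / 2)) ^ 2 := by
    have h1 := Finset.prod_range_add (fun i : ℕ => if i < n % 2 then (1 : ℤ) else 2) (n % 2)
      (n - n % 2)
    rw [show n % 2 + (n - n % 2) = n by omega, Finset.prod_range] at h1
    rw [h1, Finset.prod_congr rfl fun i hi => if_pos (Finset.mem_range.1 hi),
      Finset.prod_congr rfl fun i _ => if_neg (by omega : ¬ n % 2 + i < n % 2)]
    simp only [Finset.prod_const, one_pow, one_mul, Finset.card_range]
    rw [← pow_mul]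
    congr 1
    omega
  rw [sq, ← hdiag, ← Matrix.det_diagonal, ← Matrix.det_mul (halfGram A), ← h, Matrix.det_mul,
    Matrix.det_transpose]

lemma linearIndependent_halfGram (hA : A.IsSymm) (hd : ∀ i, A i i = 0)
    (hdvd : (2 : ℤ) ^ (n / 2) ∣ (walkMat A).det)
    (hW : ¬ (2 : ℤ) ^ (n / 2 + 1) ∣ (walkMat A).det) :
    LinearIndependent (ZMod 2) (redMat 2 (halfGram A)).col := by
  obtain ⟨w, hw⟩ := hdvd
  have hw2 : ¬ (2 : ℤ) ∣ w := by
    rintro ⟨q, rfl⟩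
    exact hW ⟨q, by rw [hw]; ring⟩
  have h := det_walkMat_sq hA hd
  rw [hw, mul_pow, mul_comm] at h
  have hS : (halfGram A).det = w ^ 2 :=
    (mul_right_cancel₀ (pow_ne_zero 2 (pow_ne_zero _ two_ne_zero)) h).symm
  rw [Matrix.linearIndependent_cols_iff_isUnit, Matrix.isUnit_iff_isUnit_det, isUnit_iff_ne_zero]
  have hdet : (redMat 2 (halfGram A)).det = ((halfGram A).det : ZMod 2) :=
    (RingHom.map_det (Int.castRingHom (ZMod 2)) _).symm
  rw [hdet, hS, Ne, ZMod.intCast_zmod_eq_zero_iff_dvd]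
  exact fun h => hw2 (Int.prime_two.dvd_of_dvd_pow h)

/-- Modulo four, the quadratic form `u ↦ uᵀ Aᵏ u` on combinations of the vectors `Aⁱ e` only sees
the diagonal terms, and these are read off from the half Gram matrix, which is invertible
modulo two. -/
lemma eq_zero_of_four_dvd (hA : A.IsSymm) (hd : ∀ i, A i i = 0)
    (hdvd : (2 : ℤ) ^ (n / 2) ∣ (walkMat A).det)
    (hW : ¬ (2 : ℤ) ^ (n / 2 + 1) ∣ (walkMat A).det) (v : Fin n → ℤ)
    (hv : ∀ k, (2 : ℤ) ^ 2 ∣ v ⬝ᵥ (A ^ k *ᵥ v)) (x : Fin (n / 2) → ZMod 2)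
    (hx : redVec 2 v = ∑ i, x i • redVec 2 (A ^ (i + n % 2 : ℕ) *ᵥ 1)) : x = 0 := by
  obtain ⟨y, hy⟩ : ∃ y : Fin (n / 2) → ℤ, redVec 2 y = x :=
    ⟨fun i => (x i).val, by ext; simp [redVec]⟩
  set u : Fin n → ℤ := ∑ i, y i • (A ^ (i + n % 2 : ℕ) *ᵥ 1) with hu
  have hred : redVec 2 (v - u) = 0 := by
    ext j
    have := congrFun hx j
    rw [← hy] at this
    simp only [redVec, Finset.sum_apply, Pi.smul_apply, smul_eq_mul] at this
    simp [redVec, hu, this]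
  choose z hz using (redVec_eq_zero_iff 2 _).1 hred
  have hvu : v = u + (2 : ℤ) • z := by
    ext j
    have := hz j
    simp only [Pi.sub_apply] at this
    simp only [Pi.add_apply, Pi.smul_apply, smul_eq_mul]
    push_cast at this
    omega
  -- Replacing `v` by `u` changes the quadratic forms by multiples of four.
  have hu4 : ∀ k, (2 : ℤ) ^ 2 ∣ u ⬝ᵥ (A ^ k *ᵥ u) := by
    intro k
    have h1 := hv k
    have hsymm : u ⬝ᵥ (A ^ k *ᵥ z) = z ⬝ᵥ (A ^ k *ᵥ u) := by
      rw [Matrix.dotProduct_mulVec, ← Matrix.mulVec_transpose, (hA.pow k).eq, dotProduct_comm]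
    have h2 : v ⬝ᵥ (A ^ k *ᵥ v) =
        u ⬝ᵥ (A ^ k *ᵥ u) + 2 ^ 2 * (z ⬝ᵥ (A ^ k *ᵥ u) + z ⬝ᵥ (A ^ k *ᵥ z)) := by
      rw [hvu]
      simp only [Matrix.mulVec_add, Matrix.mulVec_smul, dotProduct_add, add_dotProduct,
        dotProduct_smul, smul_dotProduct, smul_eq_mul, hsymm]
      ring
    rw [h2] at h1
    exact (dvd_add_left (Dvd.intro _ rfl)).1 h1
  have hquad : ∀ k, u ⬝ᵥ (A ^ k *ᵥ u) =
      ∑ i, y i * ∑ j : Fin (n / 2), walkCount A (i + n % 2 + (k + (j + n % 2))) * y j := by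
    intro k
    have h1 : A ^ k *ᵥ u = ∑ j, y j • (A ^ (k + (j + n % 2) : ℕ) *ᵥ 1) := by
      simp only [hu, Matrix.mulVec_sum, Matrix.mulVec_smul, Matrix.mulVec_mulVec, ← pow_add]
    rw [h1, hu, sum_dotProduct]
    refine Finset.sum_congr rfl fun i _ => ?_
    rw [smul_dotProduct, dotProduct_sum, smul_eq_mul]
    congr 1
    refine Finset.sum_congr rfl fun j _ => ?_
    rw [dotProduct_smul, dotProduct_pow_mulVec hA, smul_eq_mul, mul_comm]
    rfl
  have hdiag : ∀ k, ∑ i : Fin (n / 2),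
      x i * ((walkCount A (k + 2 * (i + n % 2)) / 2 : ℤ) : ZMod 2) = 0 := by
    intro k
    let H : Matrix (Fin (n / 2)) (Fin (n / 2)) (ZMod 2) := Matrix.of fun i j =>
      ((walkCount A (i + n % 2 + (k + (j + n % 2))) / 2 : ℤ) : ZMod 2)
    have hH : H.IsSymm := by
      ext i j
      simp only [H, Matrix.transpose_apply, Matrix.of_apply]
      congr 3
      omega
    have h1 := hu4 k
    have h2 : u ⬝ᵥ (A ^ k *ᵥ u) =
        2 * ∑ i, y i * ∑ j : Fin (n / 2), walkCount A (i + n % 2 + (k + (j + n % 2))) / 2 * y j := by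
      rw [hquad, Finset.mul_sum]
      refine Finset.sum_congr rfl fun i _ => ?_
      rw [mul_left_comm]
      congr 1
      rw [Finset.mul_sum]
      refine Finset.sum_congr rfl fun j _ => ?_
      rw [← mul_assoc, Int.mul_ediv_cancel' (two_dvd_walkCount hA hd (by omega))]
    rw [h2, sq] at h1
    have h3 := (ZMod.intCast_zmod_eq_zero_iff_dvd _ 2).2 (Int.dvd_of_mul_dvd_mul_left two_ne_zero h1)
    have h4 := dotProduct_mulVec_self_eq_diag hH x
    have h5 : x ⬝ᵥ (H *ᵥ x) = 0 := by
      rw [← h3, ← hy]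
      simp [dotProduct, mulVec, redVec, H]
    rw [← h5, h4]
    refine Finset.sum_congr rfl fun i _ => ?_
    simp only [H, Matrix.of_apply]
    congr 4
    omega
  let f : Fin (n / 2) → Fin n := fun i => ⟨2 * (i + n % 2), by omega⟩
  have hf : Function.Injective f := fun i j hij => by
    have := congrArg Fin.val hij
    simp only [f] at this
    exact Fin.ext (by omega)
  have hind := (linearIndependent_halfGram hA hd hdvd hW).comp f hf
  rw [Fintype.linearIndependent_iff] at hind
  refine _root_.funext fun i => hind x ?_ i
  ext k
  rw [Pi.zero_apply, ← hdiag k, Finset.sum_apply]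
  refine Finset.sum_congr rfl fun i _ => ?_
  have hi : ¬ 2 * ((i : ℕ) + n % 2) < n % 2 := by omega
  have h1 : halfGram A k (f i) = walkCount A (k + 2 * (i + n % 2)) / 2 := if_neg hi
  rw [← h1]
  rfl

/-- The kernel of `Wᵀ` modulo two has dimension `⌊n/2⌋`, hence is spanned by the independent vectors
`Aⁱ e` with `n % 2 ≤ i < ⌈n/2⌉` lying in it. -/
lemma not_isWalkIsotropic_two (hA : A.IsSymm) (hd : ∀ i, A i i = 0)
    (hdvd : (2 : ℤ) ^ (n / 2) ∣ (walkMat A).det)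
    (hW : ¬ (2 : ℤ) ^ (n / 2 + 1) ∣ (walkMat A).det) (v : Fin n → ℤ) :
    ¬ IsWalkIsotropic 2 A v := by
  intro hv
  let g : Fin (n / 2) → Fin n → ZMod 2 := fun i => redVec 2 (A ^ (i + n % 2 : ℕ) *ᵥ 1)
  have hg : LinearIndependent (ZMod 2) g := by
    rw [Fintype.linearIndependent_iff]
    intro x hx i
    exact congrFun (eq_zero_of_four_dvd hA hd hdvd hW 0 (by simp) x
      (hx ▸ by ext; simp [redVec])) i
  let K := LinearMap.ker (redMat 2 (walkMat A)ᵀ).mulVecLin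
  have hK : ∀ w : Fin n → ℤ, redVec 2 w ∈ K ↔ ∀ i : Fin n, (2 : ℤ) ∣ 1 ⬝ᵥ (A ^ (i : ℕ) *ᵥ w) := by
    intro w
    rw [LinearMap.mem_ker, Matrix.mulVecLin_apply, ← redVec_mulVec, redVec_eq_zero_iff]
    simp only [walkMat_transpose_mulVec hA]
    rfl
  have hgK : Submodule.span (ZMod 2) (Set.range g) ≤ K := by
    rw [Submodule.span_le]
    rintro _ ⟨i, rfl⟩
    refine (hK _).2 fun k => ?_
    rw [Matrix.mulVec_mulVec, ← pow_add]
    exact two_dvd_walkCount hA hd (by omega)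
  have hdim : Module.finrank (ZMod 2) K ≤ n / 2 := by
    by_contra! hlt
    let b := Module.finBasis (ZMod 2) K
    let w : Fin (Module.finrank (ZMod 2) K) → Fin n → ℤ := fun k i =>
      (((b k : Fin n → ZMod 2) i).val : ℤ)
    have hw : ∀ k, redVec 2 (w k) = b k := fun k => by ext i; simp [w, redVec]
    have h := pow_sum_dvd_det (p := 2) (walkMat A)ᵀ w (by
      have := b.linearIndependent.map' K.subtype K.ker_subtype
      have hsub : (fun k i => ((w k i : ℤ) : ZMod 2)) = K.subtype ∘ b := _root_.funext hw
      rwa [hsub]) (fun _ => 1) (by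
      intro k i
      rw [pow_one, walkMat_transpose_mulVec hA]
      exact (hK (w k)).1 (hw k ▸ (b k).2) i)
    rw [Matrix.det_transpose, Finset.sum_const, Finset.card_univ, Fintype.card_fin, smul_eq_mul,
      mul_one] at h
    exact hW ((pow_dvd_pow 2 hlt).trans h)
  have hspan : Submodule.span (ZMod 2) (Set.range g) = K :=
    Submodule.eq_of_le_of_finrank_le hgK (by
      rw [finrank_span_eq_card hg, Fintype.card_fin]; exact hdim)
  have hvK : redVec 2 v ∈ Submodule.span (ZMod 2) (Set.range g) := by
    rw [hspan]
    exact (hK v).2 fun i => hv.dvd i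
  obtain ⟨x, hx⟩ := (Submodule.mem_span_range_iff_exists_fun _).1 hvK
  have h0 := eq_zero_of_four_dvd hA hd hdvd hW v (fun k => hv.sq_dvd k) x hx.symm
  apply hv.redVec_ne_zero
  rw [← hx, h0]
  simp

/-- A vector orthogonal to `e, Ae, …, Aⁿ⁻¹e` is orthogonal to all `Aᵏ e`. -/
lemma one_dotProduct_pow_mulVec_eq_zero {R : Type*} [CommRing R] [Nontrivial R]
    {M : Matrix (Fin n) (Fin n) R} {x : Fin n → R}
    (hx : ∀ k < n, 1 ⬝ᵥ (M ^ k *ᵥ x) = 0) (k : ℕ) : 1 ⬝ᵥ (M ^ k *ᵥ x) = 0 := by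
  have hlt : ∀ q : R[X], q.degree < n → 1 ⬝ᵥ (aeval M q *ᵥ x) = 0 := by
    intro q hq
    rcases eq_or_ne q 0 with rfl | hq0
    · simp
    rw [← natDegree_lt_iff_degree_lt hq0] at hq
    rw [aeval_eq_sum_range, Matrix.sum_mulVec, dotProduct_sum]
    refine Finset.sum_eq_zero fun i hi => ?_
    rw [Matrix.smul_mulVec, dotProduct_smul, hx i (by rw [Finset.mem_range] at hi; omega),
      smul_zero]
  rw [M.pow_eq_aeval_mod_charpoly]
  refine hlt _ ?_
  have h := degree_modByMonic_lt (X ^ k) M.charpoly_monic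
  rwa [M.charpoly_degree_eq_dim, Fintype.card_fin] at h

/-- If `det W` is even, so is the discriminant: over `𝔽₂` a nonzero vector in the kernel of `Wᵀ`
generates a totally isotropic invariant subspace. -/
lemma two_dvd_discr (hA : A.IsSymm) (hd : ∀ i, A i i = 0) (hW : (2 : ℤ) ∣ (walkMat A).det) :
    (2 : ℤ) ∣ A.charpoly.discr := by
  have hdet : (redMat 2 (walkMat A)ᵀ).det = 0 := by
    have : (redMat 2 (walkMat A)ᵀ).det = (((walkMat A)ᵀ.det : ℤ) : ZMod 2) :=
      (RingHom.map_det (Int.castRingHom (ZMod 2)) _).symm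
    rw [this, Matrix.det_transpose, ZMod.intCast_zmod_eq_zero_iff_dvd]
    exact hW
  obtain ⟨x, hx0, hx⟩ := Matrix.exists_mulVec_eq_zero_iff.2 hdet
  obtain ⟨v, rfl⟩ : ∃ v : Fin n → ℤ, redVec 2 v = x :=
    ⟨fun i => (x i).val, by ext; simp [redVec]⟩
  set M := redMat 2 A
  have hM : M.IsSymm := redMat_isSymm hA
  have h1 : ∀ k, 1 ⬝ᵥ (M ^ k *ᵥ redVec 2 v) = 0 := by
    refine one_dotProduct_pow_mulVec_eq_zero fun k hk => ?_
    have h2 := congrFun hx ⟨k, hk⟩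
    rw [← redVec_mulVec, Pi.zero_apply, redVec, walkMat_transpose_mulVec hA, redVec_dotProduct,
      redVec_mulVec, redMat_pow] at h2
    have h3 : (1 : Fin n → ZMod 2) = redVec 2 1 := by ext; simp [redVec]
    rw [h3]
    exact h2
  have hsq : ∀ y : Fin n → ZMod 2, y ⬝ᵥ y = 1 ⬝ᵥ y := by
    intro y
    have : ∀ a : ZMod 2, a * a = 1 * a := by decide
    exact Finset.sum_congr rfl fun i _ => this (y i)
  have h2 : ∀ k, redVec 2 v ⬝ᵥ (M ^ k *ᵥ redVec 2 v) = 0 := by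
    intro k
    obtain ⟨s, rfl | rfl⟩ := Nat.even_or_odd' k
    · rw [two_mul, ← dotProduct_pow_mulVec hM, hsq, h1]
    · rw [show 2 * s + 1 = s + (1 + s) by ring, ← dotProduct_pow_mulVec hM, pow_add, pow_one,
        ← Matrix.mulVec_mulVec]
      exact GenSpec.dotProduct_mulVec_self_mod_two hM (by intro i; simp [M, redMat, hd]) _
  obtain ⟨i, hi⟩ := Function.ne_iff.1 hx0
  have : Nonempty (Fin n) := ⟨i⟩
  refine (discr_charpoly_associated A).dvd_iff_dvd_right.2 ?_
  have hK : redMat 2 (aeval A (derivative A.charpoly)) *ᵥ redVec 2 v = 0 := by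
    rw [← redVec_mulVec, redVec_eq_zero_iff]
    refine dvd_aeval_derivative_charpoly_mulVec hA fun k => ?_
    rw [← ZMod.intCast_zmod_eq_zero_iff_dvd, redVec_dotProduct, redVec_mulVec, redMat_pow]
    exact h2 k
  have h0 := Matrix.exists_mulVec_eq_zero_iff.1 ⟨_, hx0, hK⟩
  have h3 : ((((aeval A (derivative A.charpoly)).det : ℤ)) : ZMod 2) = 0 :=
    (RingHom.map_det (Int.castRingHom (ZMod 2)) _).trans h0
  exact (ZMod.intCast_zmod_eq_zero_iff_dvd _ 2).1 h3

end Two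

/-! ### The rational orthogonal matrix of a pair of generalized cospectral graphs -/

/-- If all walk counts of `A` and `B` agree and `det W(A) ≠ 0`, then `W(A) W(B)⁻¹` is
orthogonal, fixes the all-one vector and conjugates `A` into `B`. -/
lemma exists_orthogonal {n : ℕ} {A B : Matrix (Fin n) (Fin n) ℚ} (hA : A.IsSymm) (hB : B.IsSymm)
    (hdet : (walkMat A).det ≠ 0) (hw : ∀ k, walkCount A k = walkCount B k) :
    ∃ Q : Matrix (Fin n) (Fin n) ℚ, Qᵀ * Q = 1 ∧ A * Q = Q * B ∧ Q *ᵥ 1 = 1 := by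
  have hgram : (walkMat A)ᵀ * walkMat A = (walkMat B)ᵀ * walkMat B := by
    ext i j
    rw [walkMat_gram hA, walkMat_gram hB, hw]
  have hgram' : (walkMat A)ᵀ * (A * walkMat A) = (walkMat B)ᵀ * (B * walkMat B) := by
    have key : ∀ {M : Matrix (Fin n) (Fin n) ℚ}, M.IsSymm → ∀ i j : Fin n,
        ((walkMat M)ᵀ * (M * walkMat M)) i j = walkCount M (i + (j + 1)) := by
      intro M hM i j
      rw [walkCount, ← dotProduct_pow_mulVec hM, pow_succ' M (j : ℕ), ← Matrix.mulVec_mulVec]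
      rfl
    ext i j
    rw [key hA, key hB, hw]
  have hdetB : (walkMat B).det ≠ 0 := by
    have := congrArg Matrix.det hgram
    rw [Matrix.det_mul, Matrix.det_mul, Matrix.det_transpose, Matrix.det_transpose] at this
    intro h
    rw [h, mul_zero] at this
    exact hdet (mul_self_eq_zero.1 this)
  have hUB : IsUnit (walkMat B).det := isUnit_iff_ne_zero.2 hdetB
  set Q := walkMat A * (walkMat B)⁻¹ with hQ
  have hQW : Q * walkMat B = walkMat A := by
    rw [hQ, Matrix.mul_assoc, Matrix.nonsing_inv_mul _ hUB, Matrix.mul_one]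
  have hQt : (walkMat A)ᵀ = (walkMat B)ᵀ * Qᵀ := by rw [← hQW, Matrix.transpose_mul]
  have hUBt : IsUnit (walkMat B)ᵀ.det := by rwa [Matrix.det_transpose]
  have hcancel : ∀ M N : Matrix (Fin n) (Fin n) ℚ,
      (walkMat B)ᵀ * (M * walkMat B) = (walkMat B)ᵀ * (N * walkMat B) → M = N := by
    intro M N h
    have h1 := congrArg ((walkMat B)ᵀ⁻¹ * ·) h
    simp only [Matrix.nonsing_inv_mul_cancel_left _ _ hUBt] at h1
    have h2 := congrArg (· * (walkMat B)⁻¹) h1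
    simpa only [Matrix.mul_nonsing_inv_cancel_right _ _ hUB] using h2
  have hQQ : Qᵀ * Q = 1 := by
    apply hcancel
    rw [Matrix.mul_assoc Qᵀ, hQW, ← Matrix.mul_assoc, ← hQt, hgram, Matrix.one_mul]
  refine ⟨Q, hQQ, ?_, ?_⟩
  · have h1 : Qᵀ * (A * Q) = B := by
      apply hcancel
      rw [Matrix.mul_assoc Qᵀ, Matrix.mul_assoc A, hQW, ← Matrix.mul_assoc (walkMat B)ᵀ, ← hQt,
        hgram']
    rw [← h1, ← Matrix.mul_assoc Q, mul_eq_one_comm.1 hQQ, Matrix.one_mul]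
  · rcases Nat.eq_zero_or_pos n with rfl | hn
    · ext i; exact i.elim0
    · have h1 : ∀ M : Matrix (Fin n) (Fin n) ℚ, walkMat M *ᵥ Pi.single ⟨0, hn⟩ 1 = 1 := by
        intro M
        ext i
        simp [walkMat]
      have h2 := congrArg (· *ᵥ Pi.single ⟨0, hn⟩ (1 : ℚ)) hQW
      simpa only [← Matrix.mulVec_mulVec, h1] using h2

/-- The level of a rational matrix: a least common denominator, together with the resulting
integral matrix. -/
lemma exists_level {m n : Type*} [Fintype m] [Fintype n] (Q : Matrix m n ℚ) :
    ∃ (ℓ : ℕ) (P : Matrix m n ℤ), 0 < ℓ ∧ P.map (Int.cast : ℤ → ℚ) = (ℓ : ℚ) • Q ∧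
      ∀ p : ℕ, p.Prime → p ∣ ℓ → ∃ i j, ¬ (p : ℤ) ∣ P i j := by
  classical
  have hex : ∃ ℓ : ℕ, 0 < ℓ ∧ ∃ P : Matrix m n ℤ, P.map (Int.cast : ℤ → ℚ) = (ℓ : ℚ) • Q := by
    refine ⟨∏ i, ∏ j, (Q i j).den, Finset.prod_pos fun i _ => Finset.prod_pos fun j _ =>
      (Q i j).den_pos, ?_⟩
    have : ∀ i j, ∃ z : ℤ, (z : ℚ) = ((∏ i, ∏ j, (Q i j).den : ℕ) : ℚ) * Q i j := by
      intro i j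
      obtain ⟨q, hq⟩ : (Q i j).den ∣ ∏ i, ∏ j, (Q i j).den :=
        (Finset.dvd_prod_of_mem _ (Finset.mem_univ j)).trans
          (Finset.dvd_prod_of_mem (fun i => ∏ j, (Q i j).den) (Finset.mem_univ i))
      refine ⟨q * (Q i j).num, ?_⟩
      rw [hq]
      push_cast
      rw [mul_comm ((Q i j).den : ℚ), mul_assoc, mul_comm ((Q i j).den : ℚ), Rat.mul_den_eq_num]
    choose P hP using this
    exact ⟨Matrix.of P, by ext i j; simpa using hP i j⟩
  obtain ⟨hpos, P, hP⟩ := Nat.find_spec hex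
  refine ⟨Nat.find hex, P, hpos, hP, fun p hp hdvd => ?_⟩
  by_contra! h
  obtain ⟨ℓ', hℓ'⟩ := hdvd
  have hp0 : (p : ℚ) ≠ 0 := Nat.cast_ne_zero.2 hp.ne_zero
  have hℓpos : 0 < ℓ' := Nat.pos_of_ne_zero fun h0 => by rw [h0, mul_zero] at hℓ'; omega
  refine Nat.find_min hex (m := ℓ') ?_ ⟨hℓpos, ?_⟩
  · rw [hℓ']
    exact lt_mul_of_one_lt_left hℓpos hp.one_lt
  · choose P' hP' using h
    refine ⟨Matrix.of P', ?_⟩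
    ext i j
    have h1 := congrFun (congrFun hP i) j
    rw [Matrix.map_apply, hP' i j, hℓ', Matrix.smul_apply, smul_eq_mul] at h1
    push_cast at h1
    rw [mul_assoc] at h1
    exact mul_left_cancel₀ hp0 h1

/-- The columns of the integral multiple `ℓ Q` of an orthogonal matrix `Q` which fixes the all-one
vector and conjugates `A` into `B` are walk-isotropic modulo every prime divisor of `ℓ` that does
not divide them. -/
lemma isWalkIsotropic_of_col {ι : Type*} [Fintype ι] [DecidableEq ι] {A B P : Matrix ι ι ℤ}
    {ℓ : ℤ} (hP : Pᵀ * P = ℓ ^ 2 • 1) (hAP : A * P = P * B) (hone : 1 ᵥ* P = ℓ • 1) {p : ℕ}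
    (hpℓ : (p : ℤ) ∣ ℓ) {i j : ι} (hij : ¬ (p : ℤ) ∣ P i j) :
    IsWalkIsotropic p A (P *ᵥ Pi.single j 1) := by
  have hpow : ∀ k, A ^ k * P = P * B ^ k := by
    intro k
    induction k with
    | zero => simp
    | succ k ih => rw [pow_succ, pow_succ, Matrix.mul_assoc, hAP, ← Matrix.mul_assoc, ih,
        Matrix.mul_assoc]
  refine ⟨fun h => hij ?_, fun k => ?_, fun k => ?_⟩
  · have := (redVec_eq_zero_iff p _).1 h i
    simpa using this
  · rw [Matrix.mulVec_mulVec, hpow, Matrix.dotProduct_mulVec, ← Matrix.vecMul_transpose,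
      Matrix.vecMul_vecMul, ← Matrix.mul_assoc, hP, Matrix.smul_mul, Matrix.one_mul,
      Matrix.vecMul_smul, smul_dotProduct, smul_eq_mul]
    exact (pow_dvd_pow_of_dvd hpℓ 2).mul_right _
  · rw [Matrix.mulVec_mulVec, hpow, Matrix.dotProduct_mulVec, ← Matrix.vecMul_vecMul, hone,
      Matrix.smul_vecMul, smul_dotProduct, smul_eq_mul]
    exact hpℓ.mul_right _

/-- An integral orthogonal matrix fixing the all-one vector is a permutation matrix. -/
lemma exists_perm_of_orthogonal {ι : Type*} [Fintype ι] [DecidableEq ι] {P : Matrix ι ι ℤ}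
    (hP : Pᵀ * P = 1) (hone : P *ᵥ 1 = 1) :
    ∃ σ : Equiv.Perm ι, ∀ i j, P i j = if σ i = j then 1 else 0 := by
  have hP' : P * Pᵀ = 1 := mul_eq_one_comm.1 hP
  have hsq : ∀ i, ∑ j, P i j ^ 2 = 1 := by
    intro i
    have := congrFun (congrFun hP' i) i
    simpa [Matrix.mul_apply, sq] using this
  have hsum : ∀ i, ∑ j, P i j = 1 := by
    intro i
    simpa [Matrix.mulVec, dotProduct] using congrFun hone i
  -- Each term `x ^ 2 - x` is nonnegative, and their sum over a row vanishes.
  have h01 : ∀ i j, P i j ^ 2 = P i j := by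
    intro i j
    have h1 : ∑ j, (P i j ^ 2 - P i j) = 0 := by rw [Finset.sum_sub_distrib, hsq, hsum, sub_self]
    have h2 := (Finset.sum_eq_zero_iff_of_nonneg fun j _ =>
      sub_nonneg.2 (Int.le_self_sq (P i j))).1 h1 j (Finset.mem_univ j)
    exact sub_eq_zero.1 h2
  have hone' : ∀ i, ∃ j, P i j = 1 := by
    intro i
    by_contra! h
    have h0 : ∀ j, P i j = 0 := fun j => by
      have h2 : P i j * (P i j - 1) = 0 := by rw [mul_sub, ← sq, h01]; ring
      exact (mul_eq_zero.1 h2).resolve_right fun h3 => h j (sub_eq_zero.1 h3)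
    simpa [h0] using hsum i
  choose σ hσ using hone'
  have hval : ∀ i j, P i j = if σ i = j then 1 else 0 := by
    intro i j
    split_ifs with hj
    · rw [← hj, hσ]
    · have h1 := hsq i
      rw [← Finset.add_sum_erase _ _ (Finset.mem_univ (σ i)), hσ, one_pow, add_eq_left,
        Finset.sum_eq_zero_iff_of_nonneg fun j _ => sq_nonneg _] at h1
      exact (pow_eq_zero_iff two_ne_zero).1
        (h1 j (Finset.mem_erase.2 ⟨Ne.symm hj, Finset.mem_univ j⟩))
  have hinj : Function.Injective σ := by
    intro i k hik
    by_contra hne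
    have h1 := congrFun (congrFun hP' i) k
    rw [Matrix.mul_apply, Matrix.one_apply_ne hne] at h1
    simp [hval, hik] at h1
  exact ⟨Equiv.ofBijective σ (Finite.injective_iff_bijective.1 hinj), hval⟩

/-! ### Generalized cospectral graphs -/

lemma eval_charpoly_neg_sub_one {ι R : Type*} [CommRing R] [Fintype ι] [DecidableEq ι]
    (M : Matrix ι ι R) (t : R) :
    (-M - 1).charpoly.eval t = (-1) ^ Fintype.card ι * M.charpoly.eval (-(t + 1)) := by
  rw [Matrix.eval_charpoly, Matrix.eval_charpoly, ← Matrix.det_neg]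
  congr 1
  simp only [map_neg, map_add, map_one]
  abel

lemma adjMatrix_sub_ones_eq {V : Type*} [Fintype V] [DecidableEq V] (G : SimpleGraph V)
    [DecidableRel G.Adj] :
    G.adjMatrix ℤ + (-1 : ℤ) • Matrix.of (fun _ _ => 1) = -Gᶜ.adjMatrix ℤ - 1 := by
  ext i j
  by_cases hij : i = j
  · subst hij; simp
  · by_cases h : G.Adj i j <;> simp [hij, h, SimpleGraph.compl_adj]

lemma map_charpoly_adjMatrix {V R : Type*} [CommRing R] [Fintype V] [DecidableEq V]
    (G : SimpleGraph V) [DecidableRel G.Adj] :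
    (G.adjMatrix ℤ).charpoly.map (Int.castRingHom R) = (G.adjMatrix R).charpoly := by
  rw [← Matrix.charpoly_map]
  congr 1
  ext i j
  simp [SimpleGraph.adjMatrix_apply]

lemma charpoly_adjMatrix_eq_of_adjSpectrum_eq {V W : Type*} [Fintype V] [DecidableEq V] [Fintype W]
    [DecidableEq W] {G : SimpleGraph V} [DecidableRel G.Adj] {H : SimpleGraph W}
    [DecidableRel H.Adj] (h : GenSpec.adjSpectrum G = GenSpec.adjSpectrum H) :
    (G.adjMatrix ℤ).charpoly = (H.adjMatrix ℤ).charpoly := by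
  have hC : (G.adjMatrix ℂ).charpoly = (H.adjMatrix ℂ).charpoly := by
    rw [(IsAlgClosed.splits (G.adjMatrix ℂ).charpoly).eq_prod_roots_of_monic
        (G.adjMatrix ℂ).charpoly_monic,
      (IsAlgClosed.splits (H.adjMatrix ℂ).charpoly).eq_prod_roots_of_monic
        (H.adjMatrix ℂ).charpoly_monic]
    exact congrArg (fun s : Multiset ℂ => (s.map fun a => X - C a).prod) h
  apply Polynomial.map_injective (Int.castRingHom ℂ) Int.cast_injective
  rw [map_charpoly_adjMatrix, map_charpoly_adjMatrix, hC]

lemma charpoly_adjMatrix_sub_ones_eq {V W : Type*} [Fintype V] [DecidableEq V] [Fintype W]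
    [DecidableEq W] {G : SimpleGraph V} [DecidableRel G.Adj] {H : SimpleGraph W}
    [DecidableRel H.Adj] (hcard : Fintype.card V = Fintype.card W)
    (h : GenSpec.adjSpectrum Gᶜ = GenSpec.adjSpectrum Hᶜ) :
    (G.adjMatrix ℤ + (-1 : ℤ) • Matrix.of (fun _ _ => 1)).charpoly =
      (H.adjMatrix ℤ + (-1 : ℤ) • Matrix.of (fun _ _ => 1)).charpoly := by
  rw [adjMatrix_sub_ones_eq, adjMatrix_sub_ones_eq]
  refine Polynomial.funext fun t => ?_
  rw [eval_charpoly_neg_sub_one, eval_charpoly_neg_sub_one,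
    charpoly_adjMatrix_eq_of_adjSpectrum_eq h, hcard]

lemma walkCount_map_intCast {n : ℕ} (A : Matrix (Fin n) (Fin n) ℤ) (k : ℕ) :
    walkCount (A.map (Int.cast : ℤ → ℚ)) k = ((walkCount A k : ℤ) : ℚ) := by
  have hpow : (A.map (Int.cast : ℤ → ℚ)) ^ k = (A ^ k).map (Int.cast : ℤ → ℚ) :=
    (map_pow (Int.castRingHom ℚ).mapMatrix A k).symm
  simp [walkCount, hpow, dotProduct, mulVec]

lemma walkMat_map_intCast {n : ℕ} (A : Matrix (Fin n) (Fin n) ℤ) :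
    walkMat (A.map (Int.cast : ℤ → ℚ)) = (walkMat A).map (Int.cast : ℤ → ℚ) := by
  ext i j
  have hpow : (A.map (Int.cast : ℤ → ℚ)) ^ (j : ℕ) = (A ^ (j : ℕ)).map (Int.cast : ℤ → ℚ) :=
    (map_pow (Int.castRingHom ℚ).mapMatrix A j).symm
  simp [walkMat, hpow, dotProduct, mulVec]

/-- If no walk-isotropic vector exists modulo any prime, then the level of the orthogonal matrix
attached to `B` is one, and `B` is obtained from `A` by a permutation. -/
lemma exists_perm_of_charpoly_eq {n : ℕ} {A B : Matrix (Fin n) (Fin n) ℤ} (hA : A.IsSymm)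
    (hB : B.IsSymm) (hdet : (walkMat A).det ≠ 0) (hchar : A.charpoly = B.charpoly)
    (hchar' : (A + (-1 : ℤ) • Matrix.of fun _ _ => 1).charpoly =
      (B + (-1 : ℤ) • Matrix.of fun _ _ => 1).charpoly)
    (hiso : ∀ p : ℕ, p.Prime → ∀ v, ¬ IsWalkIsotropic p A v) :
    ∃ σ : Equiv.Perm (Fin n), ∀ i j, A i j = B (σ i) (σ j) := by
  have hw : ∀ k, walkCount (A.map (Int.cast : ℤ → ℚ)) k =
      walkCount (B.map (Int.cast : ℤ → ℚ)) k := by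
    intro k
    rw [walkCount_map_intCast, walkCount_map_intCast,
      walkCount_eq_of_charpoly_eq A B (-1) (by norm_num) hchar hchar' k]
  have hdetQ : (walkMat (A.map (Int.cast : ℤ → ℚ))).det ≠ 0 := by
    have h1 : ((walkMat A).map (Int.cast : ℤ → ℚ)).det = ((walkMat A).det : ℚ) :=
      (RingHom.map_det (Int.castRingHom ℚ) (walkMat A)).symm
    rw [walkMat_map_intCast, h1]
    exact_mod_cast hdet
  obtain ⟨Q, hQQ, hAQ, hQ1⟩ := exists_orthogonal (hA.map _) (hB.map _) hdetQ hw
  obtain ⟨ℓ, P, hℓ, hP, hlevel⟩ := exists_level Q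
  have hinj : ∀ {M N : Matrix (Fin n) (Fin n) ℤ},
      M.map (Int.cast : ℤ → ℚ) = N.map (Int.cast : ℤ → ℚ) → M = N :=
    fun h => Matrix.map_injective Int.cast_injective h
  have hmul : ∀ M N : Matrix (Fin n) (Fin n) ℤ, (M * N).map (Int.cast : ℤ → ℚ) =
      M.map Int.cast * N.map Int.cast := fun M N => Matrix.map_mul (f := Int.castRingHom ℚ)
  have hPP : Pᵀ * P = (ℓ : ℤ) ^ 2 • 1 := by
    apply hinj
    rw [hmul, Matrix.transpose_map, hP, Matrix.transpose_smul, Matrix.smul_mul, Matrix.mul_smul,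
      hQQ]
    ext i j
    simp only [Matrix.smul_apply, Matrix.map_apply, Matrix.one_apply, smul_eq_mul]
    split_ifs <;> push_cast <;> ring
  have hAP : A * P = P * B := by
    apply hinj
    rw [hmul, hmul, hP, Matrix.mul_smul, Matrix.smul_mul, hAQ]
  have hQt : 1 ᵥ* Q = 1 := by
    conv_lhs => rw [← hQ1]
    rw [← Matrix.mulVec_transpose, Matrix.mulVec_mulVec, hQQ, Matrix.one_mulVec]
  have hP1 : 1 ᵥ* P = (ℓ : ℤ) • 1 := by
    ext j
    have h1 := congrFun hQt j
    have h2 : ∀ i, (P i j : ℚ) = ℓ * Q i j := fun i => congrFun (congrFun hP i) j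
    rw [Matrix.vecMul, one_dotProduct, Pi.one_apply] at h1
    have h3 : ((∑ i, P i j : ℤ) : ℚ) = ℓ := by
      push_cast
      rw [Finset.sum_congr rfl fun i _ => h2 i, ← Finset.mul_sum, h1, mul_one]
    rw [Matrix.vecMul, one_dotProduct]
    simpa using (by exact_mod_cast h3 : ∑ i, P i j = (ℓ : ℤ))
  have hℓ1 : ℓ = 1 := by
    rw [Nat.eq_one_iff_not_exists_prime_dvd]
    intro p hp hdvd
    obtain ⟨i, j, hij⟩ := hlevel p hp hdvd
    exact hiso p hp _
      (isWalkIsotropic_of_col hPP hAP hP1 (Int.natCast_dvd_natCast.2 hdvd) hij)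
  subst hℓ1
  have hPone : P *ᵥ 1 = 1 := by
    ext i
    have h1 := congrFun hQ1 i
    have h2 : ∀ j, (P i j : ℚ) = Q i j := fun j => by
      have := congrFun (congrFun hP i) j
      simpa using this
    rw [Matrix.mulVec, dotProduct_one, Pi.one_apply] at h1 ⊢
    rw [Finset.sum_congr rfl fun j _ => (h2 j).symm] at h1
    exact_mod_cast h1
  obtain ⟨σ, hσ⟩ := exists_perm_of_orthogonal (by simpa using hPP) hPone
  refine ⟨σ, fun i j => ?_⟩
  have h1 := congrFun (congrFun hAP i) (σ j)
  simpa [Matrix.mul_apply, hσ] using h1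

/-- No walk-isotropic vector exists under the arithmetic conditions of the theorem. -/
lemma not_isWalkIsotropic_of_theta {n : ℕ} (G : SimpleGraph (Fin n)) [DecidableRel G.Adj]
    (hodd : Odd (GenSpec.theta G))
    (hsq : ∀ (p : ℕ) [Fact p.Prime], p ^ 2 ∣ GenSpec.theta G → Squarefree (GenSpec.Phi p G))
    (p : ℕ) (hp : p.Prime) (v : Fin n → ℤ) : ¬ IsWalkIsotropic p (G.adjMatrix ℤ) v := by
  intro hv
  have : Fact p.Prime := ⟨hp⟩
  have hA : (G.adjMatrix ℤ).IsSymm := G.isSymm_adjMatrix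
  have hd : ∀ i, G.adjMatrix ℤ i i = 0 := by simp
  have hW : (walkMat (G.adjMatrix ℤ)).det = (GenSpec.walkMatrix G).det := rfl
  have hdvd := GenSpec.two_pow_dvd_det_walkMatrix G
  set w := (GenSpec.walkMatrix G).det / 2 ^ (n / 2) with hwdef
  have hw : (GenSpec.walkMatrix G).det = 2 ^ (n / 2) * w := (Int.mul_ediv_cancel' hdvd).symm
  have hθ : ∀ m : ℕ, (m : ℤ) ∣ w → (m : ℤ) ∣ (G.adjMatrix ℤ).charpoly.discr →
      m ∣ GenSpec.theta G := fun m h1 h2 => Int.natCast_dvd_natCast.1 (Int.dvd_coe_gcd h1 h2)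
  rcases hp.eq_two_or_odd' with rfl | hpodd
  · have hw2 : ¬ (2 : ℤ) ∣ w := by
      intro h
      have h2 := two_dvd_discr hA hd (hW ▸ hw ▸ h.mul_left _)
      exact (Nat.not_even_iff_odd.2 hodd) (even_iff_two_dvd.2 (hθ 2 h h2))
    refine not_isWalkIsotropic_two hA hd hdvd (fun h => hw2 ?_) v hv
    rw [hW, hw, pow_succ] at h
    exact Int.dvd_of_mul_dvd_mul_left (by positivity) h
  · have h1 : ((p ^ 2 : ℕ) : ℤ) ∣ w := by
      have h2 := hv.sq_dvd_det_walkMat hA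
      rw [hW, hw] at h2
      have hcop : IsCoprime ((p : ℤ) ^ 2) (2 ^ (n / 2)) := by
        refine IsCoprime.pow ?_
        have := (Nat.Coprime.symm (Nat.coprime_two_left.2 hpodd))
        exact_mod_cast Nat.isCoprime_iff_coprime.2 this
      push_cast
      exact hcop.dvd_of_dvd_mul_left h2
    have h2 : ((p ^ 2 : ℕ) : ℤ) ∣ (G.adjMatrix ℤ).charpoly.discr := by
      push_cast
      exact hv.sq_dvd_discr hA
    have hred : redMat p (G.adjMatrix ℤ) = G.adjMatrix (ZMod p) := by
      ext i j
      simp [redMat, SimpleGraph.adjMatrix_apply]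
    classical
    have h3 := hsq p (hθ _ h1 h2)
    have h4 := hv.not_squarefree_gcd hA
    rw [hred] at h4
    apply h4
    refine h3.squarefree_of_dvd ?_
    rw [GenSpec.Phi, dvd_normalize_iff]

theorem corollary1 {n : ℕ} (G : SimpleGraph (Fin n)) [DecidableRel G.Adj]
    (hG : GenSpec.IsControllable G) (hodd : Odd (GenSpec.theta G))
    (hsq : ∀ (p : ℕ) [Fact p.Prime], p ^ 2 ∣ GenSpec.theta G → Squarefree (GenSpec.Phi p G)) :
    GenSpec.IsDGS G := by
  intro W _ _ H _ ⟨hspec, hspec'⟩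
  have hchar := charpoly_adjMatrix_eq_of_adjSpectrum_eq hspec
  have hcard : Fintype.card W = Fintype.card (Fin n) := by
    have := congrArg natDegree hchar
    rwa [Matrix.charpoly_natDegree_eq_dim, Matrix.charpoly_natDegree_eq_dim] at this
  have hchar' := charpoly_adjMatrix_sub_ones_eq hcard hspec'
  let e : W ≃ Fin n := Fintype.equivOfCardEq hcard
  have hB : (Matrix.reindex e e (H.adjMatrix ℤ)).IsSymm := H.isSymm_adjMatrix.submatrix _
  obtain ⟨σ, hσ⟩ := exists_perm_of_charpoly_eq (A := G.adjMatrix ℤ)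
    (B := Matrix.reindex e e (H.adjMatrix ℤ)) G.isSymm_adjMatrix hB hG
    (by rw [Matrix.charpoly_reindex, hchar]) (by
      rw [← hchar', ← Matrix.charpoly_reindex e]
      rfl) (fun p hp v => not_isWalkIsotropic_of_theta G hodd hsq p hp v)
  refine ⟨⟨e.trans σ.symm, fun {a b} => ?_⟩⟩
  have h := hσ (σ.symm (e a)) (σ.symm (e b))
  simp only [Equiv.apply_symm_apply, Matrix.reindex_apply, Matrix.submatrix_apply,
    Equiv.symm_apply_apply, SimpleGraph.adjMatrix_apply] at h
  simp only [Equiv.trans_apply]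
  by_cases h1 : G.Adj (σ.symm (e a)) (σ.symm (e b)) <;> by_cases h2 : H.Adj a b <;> simp_all
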